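/- **The $2kN$ Lemma.** Let $N\ge 2$, $\theta=2\pi/2N$, $a=2\cos\theta$, and let $Df(x,y)=(y,\,f(-x+ay))$ on $[-1,1)^2$, where $f(v)=((v+1)\bmod 2)-1$ (digital filter map). Call a point regular if its whole forward $Df$-orbit stays in $(-1,1)^2$. A *periodic region* $U$ of $Df$ is the set of all regular points having the same symbol sequence (overflow $-x+ay\ge 1$ / in bounds / underflow $-x+ay<-1$ along the orbit) as a given regular periodic point. Its *center* $c$ is its centroid, and its *period* $k$ is the least period of $c$ under $Df$. Let $P$ be the regular $2N$-gon centered at the origin whose edges are at distance $1$ from the origin, one of them on the line $y=1$. Let $\tau(p)=2v-p$ be the Tangent map (outer billiards) of $P$, where $v$ is the vertex at which the clockwise supporting ray from $p$ touches $P$ ($\tau(p)$ is undefined if $p\in P$ or if this ray contains an edge of $P$). A *periodic tile* of $\tau$ is the set of all points having the same infinite sequence of contact vertices as a given periodic point, all of whose iterates are defined. Let $L(x,y)=(x\cot\theta-y/\sin\theta,\;x)$, which carries the square to a rhombus (the *trapezoid*) circumscribed about $P$. Let $U$ be a periodic region of $Df$ with period $k$ that does not contain the origin (the region of the origin corresponds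 to $P$ itself, where $\tau$ is undefined). Then $c\in U$, and $c$ is periodic, so $k\geq 1$. Let $O$ be the $Df$-orbit of $c$ and $-O$ the complementary orbit, and put $m=2k$ if $-O\ne O$, and $m=k$ in the exceptional case $-O=O$. Then: 1. (*Trapezoid space.*) The sets $L(Df^i(U))$ and $L(-Df^i(U))$, $i\ge 0$, form exactly $m$ distinct sets. They are pairwise disjoint, are $L$-images of periodic regions of $Df$, and are all congruent to $L(U)$. 2. (*Tangent space.*) Rotate these sets about the origin through $j\theta$, $0\le j<N$ (the $N$ trapezoids), and take all their iterates under $\tau$. One gets exactly $mN$ distinct sets. They are pairwise disjoint periodic tiles of $\tau$, all congruent to $L(U)$. 3. (*Periods.*) The centroid of each of these $mN$ tiles lies in the tile and is periodic under $\tau$. Choosing one representative from each $\tau$-orbit of these centers, the least periods of the representatives sum to $mN$. In particular, if $-O\ne O$, then $U$ accounts for $2k$ congruent tiles in trapezoid space and for $2kN$ congruent tiles in Tangent space, and the periods of the latter sum to $2kN$. -/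

import Mathlib

open MeasureTheory

noncomputable section

namespace DigitalFilter

/-- The angle `θ = 2π / 2N`. -/
def angle (N : ℕ) : ℝ := 2 * Real.pi / (2 * N)

/-- The sawtooth `f(v) = Mod(v + 1, 2) - 1`, with values in `[-1, 1)`. -/
def sawtooth (v : ℝ) : ℝ := 2 * Int.fract ((v + 1) / 2) - 1

/-- The linear form `-x + a y` with `a = 2 cos θ`, i.e. the accumulator before overflow. -/
def accum (N : ℕ) (z : ℝ × ℝ) : ℝ := -z.1 + 2 * Real.cos (angle N) * z.2

/-- The digital filter map `Df(x, y) = (y, f(-x + a y))` with `a = 2 cos θ`, `θ = 2π / 2N`.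
It is used on the square `[-1, 1)²`, which it maps to itself. -/
def Df (N : ℕ) (z : ℝ × ℝ) : ℝ × ℝ := (z.2, sawtooth (accum N z))

/-- The symbol of a point: `1` for overflow, `-1` for underflow, `0` for in bounds. -/
def symb (N : ℕ) (z : ℝ × ℝ) : ℤ :=
  if 1 ≤ accum N z then 1 else if accum N z < -1 then -1 else 0

/-- Points all of whose iterates lie in the open square `(-1, 1)²`. Since `f = -1` exactly at the
jumps of `f`, these are the points whose orbit never meets a discontinuity of `Df`
or the boundary of the square. -/
def DfRegular (N : ℕ) : Set (ℝ × ℝ) :=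
  {z | ∀ n : ℕ, (Df N)^[n] z ∈ Set.Ioo (-1 : ℝ) 1 ×ˢ Set.Ioo (-1 : ℝ) 1}

/-- The region of `z`: the regular points with the same symbol sequence as `z`. -/
def DfCell (N : ℕ) (z : ℝ × ℝ) : Set (ℝ × ℝ) :=
  {w | w ∈ DfRegular N ∧ ∀ n : ℕ, symb N ((Df N)^[n] w) = symb N ((Df N)^[n] z)}

/-- A periodic region of `Df`: the region of a regular periodic point. -/
def IsDfPeriodicRegion (N : ℕ) (U : Set (ℝ × ℝ)) : Prop :=
  ∃ z ∈ DfRegular N, z ∈ Function.periodicPts (Df N) ∧ U = DfCell N z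

/-- The center of a planar region: its centroid. -/
def center {E : Type*} [NormedAddCommGroup E] [NormedSpace ℝ E] [MeasureSpace E]
    (U : Set E) : E := ⨍ z in U, z

/-- The period of a region of `Df` is the least period of its center. -/
def DfPeriod (N : ℕ) (U : Set (ℝ × ℝ)) : ℕ := Function.minimalPeriod (Df N) (center U)

/-- The `Df`-orbit of the center of `U`. -/
def centerOrbit (N : ℕ) (U : Set (ℝ × ℝ)) : Set (ℝ × ℝ) :=
  {w | ∃ n : ℕ, (Df N)^[n] (center U) = w}

/-- The complementary orbit: the point reflection of `centerOrbit` through the origin. -/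
def complementaryOrbit (N : ℕ) (U : Set (ℝ × ℝ)) : Set (ℝ × ℝ) :=
  {w | -w ∈ centerOrbit N U}

/-- The change of coordinates from the square to the trapezoid (rhombus) in the Euclidean
plane `ℂ`: the linear map `(x, y) ↦ (x, -x cot θ + y / sin θ)`, which conjugates the linear
part of `Df` to the rotation by `-θ`, followed by the rotation by `π / 2`. -/
def toTrapezoid (N : ℕ) (z : ℝ × ℝ) : ℂ :=
  Complex.I *
    ⟨z.1, -z.1 * (Real.cos (angle N) / Real.sin (angle N)) + z.2 / Real.sin (angle N)⟩

/-- The vertices of the regular `2N`-gon centered at the origin whose edges are at distance `1`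
from the origin, with an edge on the line of imaginary part `1`. -/
def vertices (N : ℕ) : Set ℂ :=
  {c | ∃ j : ℕ, j < 2 * N ∧
    c = ((1 / Real.cos (angle N / 2) : ℝ) : ℂ) *
      Complex.exp (Complex.I * ((Real.pi / 2 + (j + 1 / 2) * angle N : ℝ) : ℂ))}

/-- `c` is the point of contact of the clockwise supporting ray from `p`: all the other vertices
lie strictly to the right of the ray from `p` through `c`. There is no such `c` if `p` is in the
closed polygon or on one of the extended trailing edges. -/
def IsContact (N : ℕ) (p c : ℂ) : Prop :=
  c ∈ vertices N ∧
    ∀ v ∈ vertices N, v ≠ c → ((starRingEnd ℂ) (c - p) * (v - p)).im < 0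

open Classical in
/-- The Tangent map (outer billiards map) `τ(p) = -p + 2c` of the regular `2N`-gon, where `c` is
the point of contact. Where there is no point of contact the value is irrelevant. -/
def tau (N : ℕ) (p : ℂ) : ℂ := if h : ∃ c, IsContact N p c then -p + 2 * h.choose else p

/-- Points at which all the iterates of `τ` are defined. -/
def TauRegular (N : ℕ) : Set ℂ := {p | ∀ n : ℕ, ∃ c, IsContact N ((tau N)^[n] p) c}

/-- The tile of `p`: the points with the same sequence of contact vertices (corner sequence). -/
def TauCell (N : ℕ) (p : ℂ) : Set ℂ :=
  {q | ∀ n : ℕ, ∃ c, IsContact N ((tau N)^[n] p) c ∧ IsContact N ((tau N)^[n] q) c}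

/-- A periodic tile of the Tangent map. -/
def IsTauPeriodicTile (N : ℕ) (W : Set ℂ) : Prop :=
  ∃ p ∈ TauRegular N, p ∈ Function.periodicPts (tau N) ∧ W = TauCell N p

/-- Congruence of subsets of the Euclidean plane. -/
def AreCongruent (A B : Set ℂ) : Prop := ∃ e : ℂ ≃ᵢ ℂ, e '' A = B

/-- The tiles in trapezoid space that `U` accounts for: the images of the regions `Dfⁱ(U)` along
the orbit of `U` and of the regions `-Dfⁱ(U)` along the complementary orbit. -/
def trapezoidTiles (N : ℕ) (U : Set (ℝ × ℝ)) : Set (Set ℂ) :=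
  {V | ∃ i : ℕ, V = toTrapezoid N '' ((Df N)^[i] '' U) ∨
    V = toTrapezoid N '' ((fun w => -w) '' ((Df N)^[i] '' U))}

/-- The tiles in Tangent space that `U` accounts for: all iterates under `τ` of the tiles of `U`
in the `N` trapezoids that one gets by rotating the trapezoid through `0, θ, …, (N - 1)θ`. -/
def tangentTiles (N : ℕ) (U : Set (ℝ × ℝ)) : Set (Set ℂ) :=
  {W | ∃ V ∈ trapezoidTiles N U, ∃ j : ℕ, j < N ∧ ∃ n : ℕ,
    W = (tau N)^[n] '' ((fun w => Complex.exp (Complex.I * ((j * angle N : ℝ) : ℂ)) * w) '' V)}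

end DigitalFilter

end

namespace DigitalFilter

/-! The first coordinates `x n` along a regular orbit satisfy `x (n+2) = 2 cos θ * x (n+1) - x n - 2
s n`, where `s n` is the symbol. In the trapezoid this is a rotation by `-θ` plus translations
caused by the overflows. Outside the region of the origin some symbol is nonzero, and a half-period
argument for sampled sinusoids (`neg_one_lt_of_crossing`, `symb_ne_one_of_overflow`) shows that
overflows and underflows alternate. So there is a bit `b n` in `{0, 1}`, the `mode`, with `b (n+1) =
b n + s n`.

Shifting the first coordinate by `-2 b n` gives a point `tangentPt` for which one step of `Df` is a
rotation by `-θ` followed by a translation by `-2 b (n+1)` times vertex `0` (`tangentMap_Df`). If `b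
(n+1) = 0` the step is a rotation only (passive). If `b (n+1) = 1`, the rotated point has contact
vertex `0` and the step is `τ` up to sign (active). As `τ` commutes with the symmetries of the
polygon, `Df` is `τ` modulo rotations.

Tiles correspond to regions by `tauCell_tangentPt`. One inclusion follows the dynamics. For the
other, equal contact vertices only bound the sequence at active steps; `abs_lt_one_of_contacts`
fills the gaps, again by the sinusoid argument.

It remains to count. The set `O ∪ -O` has `m` points, and negation exchanges the modes, so exactly
half of them are active. An active point with one of `2N` rotations determines a tile, and each tile
arises exactly once, which gives `(m / 2) * 2N = m N` tiles. Centroids are equivariant under affine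
maps, so `τ` permutes the `m N` centers, and the sum of the periods over orbit representatives is
the number of centers. -/

/-- The unit complex number `exp (i u θ)`. -/
noncomputable def rot (N : ℕ) (u : ℝ) : ℂ := Complex.exp (Complex.I * ((u * angle N : ℝ) : ℂ))

/-- The signed height of `p` above the line through the origin parallel to the `u`-th edge. -/
noncomputable def height (N : ℕ) (u : ℝ) (p : ℂ) : ℝ :=
  p.im * Real.cos (u * angle N) - p.re * Real.sin (u * angle N)

/-- The vertices of the polygon, indexed by a real parameter. -/
noncomputable def vertex (N : ℕ) (u : ℝ) : ℂ :=
  ((1 / Real.cos (angle N / 2) : ℝ) : ℂ) *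
    Complex.exp (Complex.I * ((Real.pi / 2 + (u + 1 / 2) * angle N : ℝ) : ℂ))

/-! ### Trigonometry of the angle `θ` -/

section angle

variable {N : ℕ}

theorem mul_angle (hN : 2 ≤ N) : N * angle N = Real.pi := by
  have : (N : ℝ) ≠ 0 := by positivity
  unfold angle; field_simp

theorem angle_pos (hN : 2 ≤ N) : 0 < angle N := by
  have := Real.pi_pos
  unfold angle; positivity

theorem angle_le (hN : 2 ≤ N) : angle N ≤ Real.pi / 2 := by
  have h := mul_angle hN
  have h2 : (2 : ℝ) ≤ N := by exact_mod_cast hN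
  nlinarith [angle_pos hN]

theorem sin_mul_angle_nonneg (hN : 2 ≤ N) {u : ℝ} (h0 : 0 ≤ u) (h1 : u ≤ N) :
    0 ≤ Real.sin (u * angle N) := by
  have hp := angle_pos hN
  apply Real.sin_nonneg_of_nonneg_of_le_pi (by positivity)
  rw [← mul_angle hN]; gcongr

theorem sin_mul_angle_pos (hN : 2 ≤ N) {u : ℝ} (h0 : 0 < u) (h1 : u < N) :
    0 < Real.sin (u * angle N) := by
  have hp := angle_pos hN
  apply Real.sin_pos_of_pos_of_lt_pi (by positivity)
  rw [← mul_angle hN]; gcongr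

theorem sin_angle_pos (hN : 2 ≤ N) : 0 < Real.sin (angle N) := by
  have h : (1 : ℝ) < N := by exact_mod_cast hN
  simpa using sin_mul_angle_pos hN one_pos h

theorem cos_half_angle_pos (hN : 2 ≤ N) : 0 < Real.cos (angle N / 2) := by
  have := angle_pos hN
  have := angle_le hN
  have := Real.pi_pos
  apply Real.cos_pos_of_mem_Ioo
  constructor <;> linarith

theorem cos_angle_nonneg (hN : 2 ≤ N) : 0 ≤ Real.cos (angle N) := by
  have := angle_pos hN
  have := angle_le hN
  have := Real.pi_pos
  apply Real.cos_nonneg_of_mem_Icc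
  constructor <;> linarith

theorem sin_mul_angle_le (hN : 2 ≤ N) {u : ℝ} (h0 : 1 ≤ u) (h1 : u ≤ N) :
    Real.sin (u * angle N) ≤ Real.sin (angle N) + Real.sin ((u - 1) * angle N) := by
  have e : u * angle N = angle N + (u - 1) * angle N := by ring
  rw [e, Real.sin_add]
  have h2 := sin_mul_angle_nonneg hN (u := u - 1) (by linarith) (by linarith)
  have h3 := sin_angle_pos hN
  nlinarith [Real.cos_le_one (angle N), Real.cos_le_one ((u - 1) * angle N)]

theorem sin_mul_angle_add_pos (hN : 2 ≤ N) {u : ℝ} (h0 : 1 ≤ u) (h1 : u ≤ N) :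
    0 < Real.sin (u * angle N) ∨ 0 < Real.sin ((u - 1) * angle N) := by
  have h2 : (2 : ℝ) ≤ N := by exact_mod_cast hN
  rcases h1.lt_or_eq with h | h
  · exact .inl (sin_mul_angle_pos hN (by linarith) h)
  · exact .inr (sin_mul_angle_pos hN (by linarith) (by linarith))

/-- Both sines are nonnegative on this range, and since `N ≥ 2` they cannot vanish together. -/
theorem sin_combination_pos (hN : 2 ≤ N) {u p q : ℝ} (h0 : 1 ≤ u) (h1 : u ≤ N) (hp : 0 < p)
    (hq : 0 < q) : 0 < p * Real.sin (u * angle N) + q * Real.sin ((u - 1) * angle N) := by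
  have h2 := sin_mul_angle_nonneg hN (u := u - 1) (by linarith) (by linarith)
  have h3 := sin_mul_angle_nonneg hN (u := u) (by linarith) (by linarith)
  rcases sin_mul_angle_add_pos hN h0 h1 with h | h <;> positivity

theorem sin_natCast_mul_angle (hN : 2 ≤ N) : Real.sin (N * angle N) = 0 := by
  rw [mul_angle hN, Real.sin_pi]

theorem sin_pred_mul_angle (hN : 2 ≤ N) : Real.sin ((N - 1) * angle N) = Real.sin (angle N) := by
  rw [sub_mul, mul_angle hN, one_mul, Real.sin_pi_sub]

end angle

/-! ### Sampled sinusoids over half a period -/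

section sinusoid

variable {N : ℕ} {H : ℕ → ℝ} {M : ℕ}

/-- Both sides solve the same second-order recurrence. The bound `M` restricts it to a finite
window, because the sequences used later are sinusoids only between two overflow events. -/
theorem sinusoid_formula
    (hH : ∀ j, j + 2 ≤ M → H (j + 2) = 2 * Real.cos (angle N) * H (j + 1) - H j)
    (j : ℕ) (hj : j + 1 ≤ M) :
    H (j + 1) * Real.sin (angle N) =
      H 1 * Real.sin ((j + 1 : ℝ) * angle N) - H 0 * Real.sin (j * angle N) := by
  have key : ∀ j : ℕ, (j + 1 ≤ M → H (j + 1) * Real.sin (angle N) =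
      H 1 * Real.sin ((j + 1 : ℝ) * angle N) - H 0 * Real.sin (j * angle N)) ∧
      (j + 2 ≤ M → H (j + 2) * Real.sin (angle N) =
      H 1 * Real.sin ((j + 2 : ℝ) * angle N) - H 0 * Real.sin ((j + 1) * angle N)) := by
    have step : ∀ u : ℝ, Real.sin ((u + 2) * angle N) =
        2 * Real.cos (angle N) * Real.sin ((u + 1) * angle N) - Real.sin (u * angle N) := by
      intro u
      have e1 : (u + 2) * angle N = (u + 1) * angle N + angle N := by ring
      have e2 : u * angle N = (u + 1) * angle N - angle N := by ring
      rw [e1, e2, Real.sin_add, Real.sin_sub]; ring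
    intro j
    induction j with
    | zero =>
      refine ⟨fun _ => by simp, fun h => ?_⟩
      rw [hH 0 h]
      have := step 0
      simp only [zero_add, one_mul, zero_mul, Real.sin_zero, sub_zero] at this
      simp only [Nat.cast_zero, zero_add, one_mul, this]
      ring
    | succ j ih =>
      refine ⟨fun h => ?_, fun h => ?_⟩
      · have := ih.2 h
        push_cast
        rw [show (j : ℝ) + 1 + 1 = j + 2 by ring]
        exact this
      · have i2 := ih.2 (by omega)
        have i1 := ih.1 (by omega)
        rw [hH (j + 1) h, sub_mul, mul_assoc, show j + 1 + 1 = j + 2 from rfl, i2, i1]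
        have s1 := step (j + 1 : ℝ)
        have s2 := step (j : ℝ)
        push_cast
        rw [s1, show (j : ℝ) + 1 + 1 = j + 2 by ring, s2]
        ring
  exact (key j).1 hj

/-- A sampled sinusoid which crosses the level `-1` upwards stays above it for half a period. -/
theorem neg_one_lt_of_crossing (hN : 2 ≤ N) (hM : M ≤ N)
    (hH : ∀ j, j + 2 ≤ M → H (j + 2) = 2 * Real.cos (angle N) * H (j + 1) - H j)
    (h0 : H 0 < -1) (h1 : -1 < H 1) {j : ℕ} (hj : 1 ≤ j) (hjM : j ≤ M) : -1 < H j := by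
  obtain ⟨i, rfl⟩ := Nat.exists_eq_add_of_le' hj
  have hf := sinusoid_formula hH i hjM
  have hi : (i : ℝ) + 1 ≤ N := by exact_mod_cast hjM.trans hM
  have hi0 : (1 : ℝ) ≤ i + 1 := by simp
  have a1 := sin_mul_angle_le hN hi0 hi
  have a2 := sin_combination_pos hN (p := H 1 + 1) (q := -H 0 - 1) hi0 hi (by linarith)
    (by linarith)
  rw [add_sub_cancel_right] at a1 a2
  have := sin_angle_pos hN
  by_contra hc
  push Not at hc
  -- By `sinusoid_formula`, `(H (i+1) + 1) sin θ` is the positive combination `a2` plus `sin θ - sin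
  -- ((i+1)θ) + sin (iθ)`, which is nonnegative by `a1`.
  nlinarith

theorem sinusoid_half_period (hN : 2 ≤ N)
    (hH : ∀ j, j + 2 ≤ N → H (j + 2) = 2 * Real.cos (angle N) * H (j + 1) - H j) :
    H N = -H 0 := by
  obtain ⟨n, rfl⟩ := Nat.exists_eq_add_of_le' (show 1 ≤ N by omega)
  have hf := sinusoid_formula hH n le_rfl
  have h1 := sin_natCast_mul_angle hN
  have h2 := sin_pred_mul_angle hN
  push_cast at h1 h2
  rw [add_sub_cancel_right] at h2
  rw [h1, h2] at hf
  have := sin_angle_pos hN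
  apply mul_right_cancel₀ this.ne'
  linarith

end sinusoid

/-! ### Rotations, heights and the vertices of the polygon -/

section rotations

variable {N : ℕ}

theorem rot_eq (u : ℝ) : rot N u = ⟨Real.cos (u * angle N), Real.sin (u * angle N)⟩ := by
  unfold rot
  rw [mul_comm, Complex.exp_mul_I, ← Complex.ofReal_cos, ← Complex.ofReal_sin]
  apply Complex.ext <;> simp only [Complex.add_re, Complex.add_im, Complex.mul_re, Complex.mul_im,
    Complex.ofReal_re, Complex.ofReal_im, Complex.I_re, Complex.I_im] <;> ring

theorem rot_zero : rot N 0 = 1 := by simp [rot]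

theorem rot_add (u v : ℝ) : rot N (u + v) = rot N u * rot N v := by
  unfold rot; rw [← Complex.exp_add]; push_cast; ring_nf

theorem rot_ne_zero (u : ℝ) : rot N u ≠ 0 := Complex.exp_ne_zero _

theorem rot_neg_mul_rot (u : ℝ) : rot N (-u) * rot N u = 1 := by
  rw [← rot_add, neg_add_cancel, rot_zero]

theorem rot_mul_rot_neg (u : ℝ) : rot N u * rot N (-u) = 1 := by
  rw [← rot_add, add_neg_cancel, rot_zero]

theorem norm_rot (u : ℝ) : ‖rot N u‖ = 1 := by
  unfold rot; rw [mul_comm]; exact Complex.norm_exp_ofReal_mul_I _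

theorem rot_self (hN : 2 ≤ N) : rot N N = -1 := by
  rw [rot_eq, mul_angle hN]; apply Complex.ext <;> simp

theorem rot_int_mul (hN : 2 ≤ N) (m : ℤ) : rot N (m * (2 * N)) = 1 := by
  rw [rot_eq, show (m : ℝ) * (2 * N) * angle N = m * (2 * Real.pi) by
    rw [← mul_angle hN]; ring]
  apply Complex.ext
  · simp
  · simpa using Real.sin_add_int_mul_two_pi 0 m

theorem exists_nat_rot_eq (hN : 2 ≤ N) (j : ℤ) : ∃ i : ℕ, i < 2 * N ∧ rot N j = rot N i := by
  have h0 : (0 : ℤ) < 2 * N := by omega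
  refine ⟨(j % (2 * N)).toNat, ?_, ?_⟩
  · have := Int.emod_lt_of_pos j h0
    have := Int.emod_nonneg j h0.ne'
    omega
  · have h1 : ((j % (2 * N)).toNat : ℤ) = j % (2 * N) :=
      Int.toNat_of_nonneg (Int.emod_nonneg j h0.ne')
    have h2 : (((j % (2 * N)).toNat : ℕ) : ℝ) = ((j % (2 * N) : ℤ) : ℝ) := by
      rw [← h1]; rfl
    have h3 : (j : ℝ) = ((j % (2 * N) : ℤ) : ℝ) + ((j / (2 * N) : ℤ) : ℝ) * (2 * N) := by
      have := Int.emod_add_mul_ediv j (2 * N)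
      have h4 : (j : ℝ) = ((j % (2 * N) + 2 * N * (j / (2 * N)) : ℤ) : ℝ) := by rw [this]
      rw [h4]; push_cast; ring
    rw [h2, h3, rot_add, rot_int_mul hN, mul_one]

theorem rot_nat_injOn (hN : 2 ≤ N) {i j : ℕ} (hi : i < 2 * N) (hj : j < 2 * N)
    (h : rot N i = rot N j) : i = j := by
  unfold rot at h
  rw [Complex.exp_eq_exp_iff_exists_int] at h
  obtain ⟨n, hn⟩ := h
  have hn' := congrArg Complex.im hn
  simp at hn'
  have hp := Real.pi_pos
  have h1 : (i : ℝ) * angle N = j * angle N + n * (2 * (N * angle N)) := by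
    rw [mul_angle hN]; exact hn'
  have h2 : (i : ℝ) = j + n * (2 * N) := by
    apply mul_right_cancel₀ (angle_pos hN).ne'
    rw [h1]; ring
  have h3 : (i : ℤ) = j + n * (2 * N) := by exact_mod_cast h2
  have h4 : n = 0 := by
    have a1 : n < 1 := by
      by_contra hc; push Not at hc; nlinarith
    have a2 : -1 < n := by
      by_contra hc; push Not at hc; nlinarith
    omega
  rw [h4] at h3; omega

theorem height_rot_mul (u v : ℝ) (p : ℂ) : height N u (rot N v * p) = height N (u - v) p := by
  simp only [height, rot_eq, Complex.mul_re, Complex.mul_im, sub_mul, Real.cos_sub, Real.sin_sub]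
  ring

theorem height_add (u : ℝ) (p q : ℂ) : height N u (p + q) = height N u p + height N u q := by
  simp [height]; ring

theorem height_sub (u : ℝ) (p q : ℂ) : height N u (p - q) = height N u p - height N u q := by
  simp [height]; ring

theorem height_two_mul (u : ℝ) (p : ℂ) : height N u (2 * p) = 2 * height N u p := by
  simp [height]; ring

theorem height_natCast (hN : 2 ≤ N) (p : ℂ) : height N N p = -height N 0 p := by
  simp [height, mul_angle hN]

theorem height_mul_sin (u : ℝ) (p : ℂ) : height N u p * Real.sin (angle N) =
    height N 1 p * Real.sin (u * angle N) - height N 0 p * Real.sin ((u - 1) * angle N) := by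
  simp [height, sub_mul, Real.sin_sub]; ring

/-- Heights over successive edge directions form a sampled sinusoid: the recurrence of the filter
without overflow. -/
theorem height_add_two (u : ℝ) (p : ℂ) : height N (u + 2) p =
    2 * Real.cos (angle N) * height N (u + 1) p - height N u p := by
  have e1 : (u + 2) * angle N = (u + 1) * angle N + angle N := by ring
  have e2 : u * angle N = (u + 1) * angle N - angle N := by ring
  simp only [height, e1, e2, Real.sin_add, Real.sin_sub, Real.cos_add, Real.cos_sub]
  ring

theorem rot_mul_vertex (u v : ℝ) : rot N u * vertex N v = vertex N (u + v) := by
  unfold rot vertex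
  rw [mul_left_comm, ← Complex.exp_add]
  push_cast; ring_nf

theorem vertex_eq (u : ℝ) : vertex N u =
    ⟨-Real.sin ((u + 1 / 2) * angle N) / Real.cos (angle N / 2),
      Real.cos ((u + 1 / 2) * angle N) / Real.cos (angle N / 2)⟩ := by
  unfold vertex
  rw [mul_comm Complex.I, Complex.exp_mul_I, ← Complex.ofReal_cos, ← Complex.ofReal_sin,
    add_comm (Real.pi / 2), Real.cos_add_pi_div_two, Real.sin_add_pi_div_two]
  apply Complex.ext <;> simp only [Complex.add_re, Complex.add_im, Complex.mul_re, Complex.mul_im,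
    Complex.ofReal_re, Complex.ofReal_im, Complex.I_re, Complex.I_im] <;> ring

theorem height_vertex (u v : ℝ) : height N u (vertex N v) =
    Real.cos ((u - v - 1 / 2) * angle N) / Real.cos (angle N / 2) := by
  have e : (u - v - 1 / 2) * angle N = u * angle N - (v + 1 / 2) * angle N := by ring
  rw [e, Real.cos_sub]
  simp only [height, vertex_eq]
  ring

theorem height_vertex_zero (hN : 2 ≤ N) : height N 0 (vertex N 0) = 1 := by
  have h := cos_half_angle_pos hN
  rw [height_vertex, show (0 - 0 - 1 / 2) * angle N = -(angle N / 2) by ring, Real.cos_neg,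
    div_self h.ne']

theorem height_one_vertex_zero (hN : 2 ≤ N) : height N 1 (vertex N 0) = 1 := by
  have h := cos_half_angle_pos hN
  rw [height_vertex, show (1 - 0 - 1 / 2) * angle N = (angle N / 2) by ring, div_self h.ne']

theorem vertex_int_mem (hN : 2 ≤ N) (j : ℤ) : vertex N j ∈ vertices N := by
  obtain ⟨i, hi, h⟩ := exists_nat_rot_eq hN j
  refine ⟨i, hi, ?_⟩
  change _ = vertex N i
  have h1 := rot_mul_vertex (N := N) j 0
  have h2 := rot_mul_vertex (N := N) i 0
  rw [add_zero] at h1 h2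
  rw [← h1, ← h2, h]

theorem rot_mul_mem_vertices (hN : 2 ≤ N) (j : ℤ) {c : ℂ} (hc : c ∈ vertices N) :
    rot N j * c ∈ vertices N := by
  obtain ⟨i, -, rfl⟩ := hc
  change rot N j * vertex N i ∈ _
  rw [rot_mul_vertex]
  exact_mod_cast vertex_int_mem hN (j + i)

theorem rot_mul_mem_vertices_iff (hN : 2 ≤ N) (j : ℤ) {c : ℂ} :
    rot N j * c ∈ vertices N ↔ c ∈ vertices N := by
  refine ⟨fun h => ?_, rot_mul_mem_vertices hN j⟩
  have := rot_mul_mem_vertices hN (-j) h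
  rwa [← mul_assoc, Int.cast_neg, rot_neg_mul_rot, one_mul] at this

/-! ### Contact vertices, the Tangent map and its cells -/

theorem IsContact.unique {p c d : ℂ} (hc : IsContact N p c) (hd : IsContact N p d) : c = d := by
  by_contra h
  have h1 := hc.2 d hd.1 (Ne.symm h)
  have h2 := hd.2 c hc.1 h
  simp only [Complex.mul_im, Complex.conj_re, Complex.conj_im] at h1 h2
  linarith

theorem isContact_rot (hN : 2 ≤ N) (j : ℤ) {p c : ℂ} (h : IsContact N p c) :
    IsContact N (rot N j * p) (rot N j * c) := by
  refine ⟨rot_mul_mem_vertices hN j h.1, fun v hv hvc => ?_⟩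
  have e1 : v = rot N j * (rot N (-j) * v) := by rw [← mul_assoc, rot_mul_rot_neg, one_mul]
  have hv' : rot N (-j) * v ∈ vertices N := by
    rw [e1, rot_mul_mem_vertices_iff hN] at hv; exact hv
  have := h.2 _ hv' (fun hh => hvc (by rw [e1, hh]))
  have e2 : (starRingEnd ℂ) (rot N j * c - rot N j * p) * (v - rot N j * p) =
      (starRingEnd ℂ) (c - p) * (rot N (-j) * v - p) := by
    have h3 : (starRingEnd ℂ) (rot N j) * rot N j = 1 := by
      rw [Complex.conj_mul', norm_rot]; simp
    have e3 : v - rot N j * p = rot N j * (rot N (-j) * v - p) := by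
      rw [mul_sub, ← e1]
    rw [e3, ← mul_sub, map_mul]
    linear_combination ((starRingEnd ℂ) (c - p) * (rot N (-j) * v - p)) * h3
  rw [e2]; exact this

theorem isContact_rot_iff (hN : 2 ≤ N) (j : ℤ) {p c : ℂ} :
    IsContact N (rot N j * p) (rot N j * c) ↔ IsContact N p c := by
  refine ⟨fun h => ?_, isContact_rot hN j⟩
  have := isContact_rot hN (-j) h
  simpa only [← mul_assoc, Int.cast_neg, rot_neg_mul_rot, one_mul] using this

/-- The chord between vertices `0` and `u` is a real multiple of `rot N ((u + 1) / 2)`, so the cross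
product is a height in that direction. -/
theorem cross_vertex_zero (p : ℂ) (u : ℝ) :
    ((starRingEnd ℂ) (vertex N 0 - p) * (vertex N u - p)).im =
      -(2 * Real.sin (u * angle N / 2) / Real.cos (angle N / 2)) *
        height N ((u + 1) / 2) (p - vertex N 0) := by
  have h1 : vertex N u - vertex N 0 =
      ((-(2 * Real.sin (u * angle N / 2) / Real.cos (angle N / 2)) : ℝ) : ℂ) *
        rot N ((u + 1) / 2) := by
    have e1 : (u + 1 / 2) * angle N = (u + 1) / 2 * angle N + u * angle N / 2 := by ring
    have e2 : (0 + 1 / 2) * angle N = (u + 1) / 2 * angle N - u * angle N / 2 := by ring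
    rw [vertex_eq, vertex_eq, rot_eq, e1, e2, Real.sin_add, Real.sin_sub, Real.cos_add,
      Real.cos_sub]
    apply Complex.ext <;> simp only [Complex.sub_re, Complex.sub_im, Complex.mul_re,
      Complex.mul_im, Complex.ofReal_re, Complex.ofReal_im] <;> ring
  have h2 : vertex N u - p = (vertex N u - vertex N 0) + (vertex N 0 - p) := by ring
  rw [h2, h1, rot_eq]
  simp only [height, Complex.mul_im, Complex.add_im, Complex.add_re, Complex.mul_re,
    Complex.conj_re, Complex.conj_im, Complex.ofReal_re, Complex.ofReal_im, Complex.sub_re,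
    Complex.sub_im]
  ring

/-- Only the two neighbours of vertex `0` matter. The condition for vertex `j` is a height at index
`(j + 1) / 2`, between `1` and `N`, and such a height is a nonnegative combination of those at the
ends. -/
theorem isContact_vertex_zero (hN : 2 ≤ N) (p : ℂ) :
    IsContact N p (vertex N 0) ↔ height N 0 p < 1 ∧ 1 < height N 1 p := by
  have hc := cos_half_angle_pos hN
  have hs := sin_angle_pos hN
  have hsin : ∀ j : ℕ, 0 < j → j < 2 * N → 0 < Real.sin (j * angle N / 2) := by
    intro j h0 h1
    have h0' : (0 : ℝ) < j := by exact_mod_cast h0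
    have h1' : (j : ℝ) < 2 * N := by exact_mod_cast h1
    have := sin_mul_angle_pos hN (u := j / 2) (by linarith) (by linarith)
    rwa [div_mul_eq_mul_div] at this
  have hne : ∀ j : ℕ, 0 < j → j < 2 * N → vertex N j ≠ vertex N 0 := by
    intro j h0 h1 h
    have h2 := rot_mul_vertex (N := N) j 0
    rw [add_zero, h] at h2
    have h3 : vertex N 0 ≠ 0 := by
      intro h4
      have := height_vertex_zero hN
      rw [h4] at this
      simp [height] at this
    have h4 : rot N j = rot N (0 : ℕ) := by
      rw [Nat.cast_zero, rot_zero]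
      exact mul_right_cancel₀ h3 (by rw [h2, one_mul])
    have := rot_nat_injOn hN h1 (by omega) h4
    omega
  have hv0 : vertex N 0 ∈ vertices N := by exact_mod_cast vertex_int_mem hN 0
  have hkey : ∀ j : ℕ, 0 < j → j < 2 * N →
      (((starRingEnd ℂ) (vertex N 0 - p) * (vertex N j - p)).im < 0 ↔
        0 < height N (((j : ℝ) + 1) / 2) (p - vertex N 0)) := by
    intro j h0 h1
    have hj := hsin j h0 h1
    have hK : 0 < 2 * Real.sin (j * angle N / 2) / Real.cos (angle N / 2) := by positivity
    rw [cross_vertex_zero, neg_mul, neg_lt_zero]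
    exact mul_pos_iff_of_pos_left hK
  constructor
  · intro h
    constructor
    · have h1 := h.2 (vertex N ((2 * N - 1 : ℕ) : ℝ)) ⟨2 * N - 1, by omega, rfl⟩
        (hne _ (by omega) (by omega))
      rw [hkey _ (by omega) (by omega), Nat.cast_sub (by omega)] at h1
      push_cast at h1
      -- The neighbour `2N - 1` gives the index `N`, half a turn away from `0`; this flips the
      -- inequality to `height N 0 p < 1`.
      rw [show (2 * (N : ℝ) - 1 + 1) / 2 = N by ring, height_natCast hN, height_sub,
        height_vertex_zero hN] at h1
      linarith
    · have h1 := h.2 (vertex N ((1 : ℕ) : ℝ)) ⟨1, by omega, rfl⟩ (hne _ (by omega) (by omega))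
      rw [hkey _ (by omega) (by omega), Nat.cast_one, show ((1 : ℝ) + 1) / 2 = 1 by norm_num,
        height_sub, height_one_vertex_zero hN] at h1
      linarith
  · rintro ⟨h0, h1⟩
    refine ⟨hv0, ?_⟩
    rintro v ⟨j, hj, rfl⟩ hv
    change vertex N j ≠ _ at hv
    change ((starRingEnd ℂ) (vertex N 0 - p) * (vertex N j - p)).im < 0
    have hj0 : 0 < j := by
      rcases Nat.eq_zero_or_pos j with rfl | h
      · simp at hv
      · exact h
    rw [hkey j hj0 hj]
    have e := height_mul_sin (N := N) (((j : ℝ) + 1) / 2) (p - vertex N 0)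
    rw [height_sub 1, height_sub 0, height_vertex_zero hN, height_one_vertex_zero hN] at e
    have hj1 : (1 : ℝ) ≤ j := by exact_mod_cast hj0
    have hj2 : (j : ℝ) + 1 ≤ 2 * N := by exact_mod_cast hj
    have := sin_combination_pos hN (u := ((j : ℝ) + 1) / 2) (p := height N 1 p - 1)
      (q := 1 - height N 0 p) (by linarith) (by linarith) (by linarith) (by linarith)
    by_contra hcon
    push Not at hcon
    nlinarith

theorem tau_eq {p c : ℂ} (h : IsContact N p c) : tau N p = -p + 2 * c := by
  have hex : ∃ c, IsContact N p c := ⟨c, h⟩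
  rw [tau, dif_pos hex, hex.choose_spec.unique h]

theorem tau_rot (hN : 2 ≤ N) (j : ℤ) (p : ℂ) : tau N (rot N j * p) = rot N j * tau N p := by
  by_cases h : ∃ c, IsContact N p c
  · obtain ⟨c, hc⟩ := h
    rw [tau_eq hc, tau_eq (isContact_rot hN j hc)]; ring
  · have h' : ¬ ∃ c, IsContact N (rot N j * p) c := by
      rintro ⟨c, hc⟩
      refine h ⟨rot N (-j) * c, ?_⟩
      rw [← isContact_rot_iff hN j, ← mul_assoc, rot_mul_rot_neg, one_mul]
      exact hc
    rw [tau, tau, dif_neg h, dif_neg h']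

theorem tau_iterate_rot (hN : 2 ≤ N) (j : ℤ) (n : ℕ) (p : ℂ) :
    (tau N)^[n] (rot N j * p) = rot N j * (tau N)^[n] p := by
  induction n generalizing p with
  | zero => rfl
  | succ n ih => rw [Function.iterate_succ_apply, Function.iterate_succ_apply, tau_rot hN, ih]

theorem mem_tauCell_rot (hN : 2 ≤ N) (j : ℤ) {p q : ℂ} (h : q ∈ TauCell N p) :
    rot N j * q ∈ TauCell N (rot N j * p) := by
  intro n
  obtain ⟨c, h1, h2⟩ := h n
  refine ⟨rot N j * c, ?_⟩
  rw [tau_iterate_rot hN, tau_iterate_rot hN]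
  exact ⟨isContact_rot hN j h1, isContact_rot hN j h2⟩

theorem mem_tauCell_rot_iff (hN : 2 ≤ N) (j : ℤ) {p q : ℂ} :
    rot N j * q ∈ TauCell N (rot N j * p) ↔ q ∈ TauCell N p := by
  refine ⟨fun h => ?_, mem_tauCell_rot hN j⟩
  have := mem_tauCell_rot hN (-j) h
  simpa only [← mul_assoc, Int.cast_neg, rot_neg_mul_rot, one_mul] using this

theorem tau_mem_tauCell {p q : ℂ} (h : q ∈ TauCell N p) : tau N q ∈ TauCell N (tau N p) := by
  intro n
  have := h (n + 1)
  rwa [Function.iterate_succ_apply, Function.iterate_succ_apply] at this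

/-- Contact vertices are unique, so a common point makes the two corner sequences equal. -/
theorem tauCell_eq_or_disjoint (p q : ℂ) :
    TauCell N p = TauCell N q ∨ Disjoint (TauCell N p) (TauCell N q) := by
  rw [or_iff_not_imp_right, Set.not_disjoint_iff]
  rintro ⟨r, hp, hq⟩
  have key : ∀ {p q : ℂ}, r ∈ TauCell N p → r ∈ TauCell N q → TauCell N p ⊆ TauCell N q := by
    intro p q hp hq s hs n
    obtain ⟨c, h1, h2⟩ := hp n
    obtain ⟨d, h3, h4⟩ := hq n
    obtain ⟨e, h5, h6⟩ := hs n
    obtain rfl := h2.unique h4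
    obtain rfl := h1.unique h5
    exact ⟨c, h3, h6⟩
  exact (key hp hq).antisymm (key hq hp)

theorem mem_tauCell_self {p : ℂ} (h : p ∈ TauRegular N) : p ∈ TauCell N p := by
  intro n
  obtain ⟨c, hc⟩ := h n
  exact ⟨c, hc, hc⟩

end rotations

/-! ### Recovering all bounds from those at the contacts -/

section recover

variable {N : ℕ} {x X : ℕ → ℝ} {s b : ℕ → ℤ}

/-- When the mode drops from `1` to `0` the underflow adds `+2` once. Lowering the initial value by
`2` absorbs it, so the whole gap becomes a pure sinusoid. -/
theorem gap_lower_crossing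
    (hX : ∀ n, X (n + 2) = 2 * Real.cos (angle N) * X (n + 1) - X n - 2 * s n)
    (hs : ∀ n, b (n + 1) = b n + s n) {n i : ℕ} (hb : b (n + 1) = 1)
    (hz : ∀ j, 1 ≤ j → j ≤ i → b (n + 1 + j) = 0) :
    ∃ H : ℕ → ℝ, H 0 = X (n + 1) - 2 ∧ (∀ j, 1 ≤ j → H j = X (n + 1 + j)) ∧
      ∀ j, j + 2 ≤ i + 1 → H (j + 2) = 2 * Real.cos (angle N) * H (j + 1) - H j := by
  refine ⟨fun j => if j = 0 then X (n + 1) - 2 else X (n + 1 + j), by simp, ?_, ?_⟩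
  · intro j hj
    simp [show j ≠ 0 by omega]
  · intro j hj
    have h1 := hX (n + 1 + j)
    have h2 := hs (n + 1 + j)
    have h3 := hz (j + 1) (by omega) (by omega)
    rw [← add_assoc] at h3
    rcases Nat.eq_zero_or_pos j with rfl | hj0
    · have h4 : s (n + 1 + 0) = -1 := by
        rw [h3] at h2; simp only [add_zero] at h2 ⊢; omega
      rw [h4] at h1
      simp only [add_zero, zero_add, if_true] at h1 ⊢
      norm_num
      rw [show n + 1 + 2 = n + 1 + 2 from rfl, h1]
      push_cast; ring
    · have h4 := hz j hj0 (by omega)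
      have h5 : s (n + 1 + j) = 0 := by omega
      rw [h5] at h1
      simp only [Nat.add_eq_zero_iff, OfNat.ofNat_ne_zero, and_false, if_false, one_ne_zero,
        hj0.ne']
      rw [← add_assoc, ← add_assoc, h1]; simp

/-- The counterpart of `gap_lower_crossing` under time reversal and negation: the gap is read
backwards from the overflow that ends it. -/
theorem gap_upper_crossing
    (hX : ∀ n, X (n + 2) = 2 * Real.cos (angle N) * X (n + 1) - X n - 2 * s n)
    (hs : ∀ n, b (n + 1) = b n + s n) {n i : ℕ} (hb : b (n + i + 1) = 1)
    (hz : ∀ j, 1 ≤ j → j ≤ i → b (n + j) = 0) :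
    ∃ H : ℕ → ℝ, H 0 = -X (n + i + 2) - 2 ∧
      (∀ j, 1 ≤ j → H j = -X (n + i + 2 - j)) ∧
      ∀ j, j + 2 ≤ i + 1 → H (j + 2) = 2 * Real.cos (angle N) * H (j + 1) - H j := by
  refine ⟨fun j => if j = 0 then -X (n + i + 2) - 2 else -X (n + i + 2 - j), by simp, ?_, ?_⟩
  · intro j hj
    simp [show j ≠ 0 by omega]
  · intro j hj
    obtain ⟨l, rfl⟩ : ∃ l, i = j + l + 1 := ⟨i - j - 1, by omega⟩
    have e2 : n + (j + l + 1) + 2 - (j + 2) = n + l + 1 := by omega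
    have e1 : n + (j + l + 1) + 2 - (j + 1) = n + l + 1 + 1 := by omega
    have e0 : n + (j + l + 1) + 2 - j = n + l + 1 + 2 := by omega
    have h1 := hX (n + l + 1)
    have h2 := hs (n + l + 1)
    have h3 := hz (l + 1) (by omega) (by omega)
    rw [← add_assoc] at h3
    simp only [Nat.add_eq_zero_iff, OfNat.ofNat_ne_zero, and_false, if_false, one_ne_zero, e0, e1,
      e2]
    rcases Nat.eq_zero_or_pos j with rfl | hj0
    · have h4 : s (n + l + 1) = 1 := by
        rw [show n + (0 + l + 1) + 1 = n + l + 1 + 1 by ring] at hb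
        omega
      rw [h4] at h1
      simp only [if_true]
      rw [show n + (0 + l + 1) + 2 = n + l + 1 + 2 by ring, h1]
      push_cast; ring
    · have h4 := hz (l + 2) (by omega) (by omega)
      rw [← add_assoc] at h4
      have h5 : s (n + l + 1) = 0 := by
        rw [show n + l + 1 + 1 = n + l + 2 by ring] at h2
        omega
      rw [h5] at h1
      simp only [hj0.ne', if_false]
      rw [h1]; push_cast; ring

/-- Here `x` is a genuine orbit and `X` a displaced sequence with the same forcing, controlled only
where the mode is `1`. Each lower bound is carried forward from the preceding active index and each
upper bound backward from the following one, by `neg_one_lt_of_crossing`. The orbit `x` is needed to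
show that gaps are shorter than half a period. -/
theorem abs_lt_one_of_contacts (hN : 2 ≤ N)
    (hx : ∀ n, x (n + 2) = 2 * Real.cos (angle N) * x (n + 1) - x n - 2 * s n)
    (hX : ∀ n, X (n + 2) = 2 * Real.cos (angle N) * X (n + 1) - X n - 2 * s n)
    (hs : ∀ n, b (n + 1) = b n + s n) (hb : ∀ n, b n = 0 ∨ b n = 1)
    (hx1 : ∀ n, |x n| < 1) {q : ℕ} (hq : 0 < q) (hper : ∀ n, X (n + q) = X n)
    (hinf : ∀ n, ∃ i, b (n + i) = 1)
    (hc : ∀ n, b (n + 1) = 1 → X (n + 1) < 1 ∧ -1 < X (n + 2)) (n : ℕ) : |X n| < 1 := by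
  have lower : ∀ n i, b (n + 1) = 1 → (∀ j, 1 ≤ j → j ≤ i → b (n + 1 + j) = 0) →
      -1 < X (n + 2 + i) := by
    intro n i hb hz
    -- Over a gap of half a period the sinusoid of `x` would reach `-(x (n+1) - 2) > 1`, against the
    -- bound on `x`.
    have hiN : i + 1 < N := by
      by_contra hcon
      obtain ⟨M, rfl⟩ : ∃ M, N = M + 1 := ⟨N - 1, by omega⟩
      obtain ⟨H, h0, h1, h2⟩ := gap_lower_crossing (i := M) hx hs hb
        (fun j hj hj' => hz j hj (by omega))
      have h3 := sinusoid_half_period hN h2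
      rw [h1 _ (by omega), h0] at h3
      have h4 := abs_lt.1 (hx1 (n + 1))
      have h5 := abs_lt.1 (hx1 (n + 1 + (M + 1)))
      linarith
    obtain ⟨H, h0, h1, h2⟩ := gap_lower_crossing hX hs hb hz
    have h3 := hc n hb
    have h4 := neg_one_lt_of_crossing hN hiN.le h2 (by linarith) (by rw [h1 1 le_rfl]; exact h3.2)
      (show 1 ≤ i + 1 by omega) le_rfl
    rw [h1 _ (by omega)] at h4
    rwa [show n + 1 + (i + 1) = n + 2 + i by ring] at h4
  have upper : ∀ n i, b (n + i + 1) = 1 → (∀ j, 1 ≤ j → j ≤ i → b (n + j) = 0) →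
      X (n + 1) < 1 := by
    intro n i hb hz
    have hiN : i + 1 < N := by
      by_contra hcon
      obtain ⟨M, rfl⟩ : ∃ M, N = M + 1 := ⟨N - 1, by omega⟩
      obtain ⟨l, rfl⟩ : ∃ l, i = M + l := ⟨i - M, by omega⟩
      rw [show n + (M + l) + 1 = (n + l) + M + 1 by ring] at hb
      obtain ⟨H, h0, h1, h2⟩ := gap_upper_crossing (n := n + l) (i := M) hx hs hb
        (fun j hj hj' => by rw [add_assoc]; exact hz _ (by omega) (by omega))
      have h3 := sinusoid_half_period hN h2
      rw [h1 _ (by omega), h0] at h3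
      have h4 := abs_lt.1 (hx1 (n + l + M + 2))
      have h5 := abs_lt.1 (hx1 (n + l + M + 2 - (M + 1)))
      linarith
    obtain ⟨H, h0, h1, h2⟩ := gap_upper_crossing hX hs hb hz
    have h3 := hc (n + i) hb
    have h4 := neg_one_lt_of_crossing hN hiN.le h2 (by linarith)
      (by rw [h1 1 le_rfl, show n + i + 2 - 1 = n + i + 1 by omega]; linarith)
      (show 1 ≤ i + 1 by omega) le_rfl
    rw [h1 _ (by omega), show n + i + 2 - (i + 1) = n + 1 by omega] at h4
    linarith
  obtain ⟨n0, hn0⟩ := hinf 1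
  rw [add_comm] at hn0
  -- Here `n + 1` is the last index below `m` with mode `1`.
  have last : ∀ m, n0 + 2 ≤ m → ∃ n i, m = n + 2 + i ∧ b (n + 1) = 1 ∧
      ∀ j, 1 ≤ j → j ≤ i → b (n + 1 + j) = 0 := by
    intro m hm
    induction m, hm using Nat.le_induction with
    | base => exact ⟨n0, 0, rfl, hn0, fun j _ _ => by omega⟩
    | succ m hm ih =>
      rcases hb m with h | h
      · obtain ⟨n, i, rfl, h1, h2⟩ := ih
        refine ⟨n, i + 1, rfl, h1, fun j hj hj' => ?_⟩
        rcases hj'.lt_or_eq with h3 | rfl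
        · exact h2 j hj (by omega)
        · rw [← h]; congr 1; ring
      · refine ⟨m - 1, 0, by omega, ?_, fun j _ _ => by omega⟩
        rw [show m - 1 + 1 = m by omega]; exact h
  have hper' : ∀ k, X (n + k * q) = X n := by
    intro k
    induction k with
    | zero => simp
    | succ k ih => rw [show n + (k + 1) * q = n + k * q + q by ring, hper, ih]
  -- Periodicity moves the index far enough to the right to have an active index before it.
  have hbig : n0 + 2 ≤ n + (n0 + 2) * q := by nlinarith
  rw [← hper' (n0 + 2)]
  generalize n + (n0 + 2) * q = m at hbig
  rw [abs_lt]
  constructor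
  · obtain ⟨n, i, rfl, h1, h2⟩ := last m hbig
    exact lower n i h1 h2
  · obtain ⟨l, rfl⟩ : ∃ l, m = l + 1 := ⟨m - 1, by omega⟩
    classical
    have hex := hinf (l + 1)
    refine upper l (Nat.find hex) ?_ ?_
    · have := Nat.find_spec hex
      rwa [add_right_comm] at this
    · intro j hj hj'
      have := Nat.find_min hex (m := j - 1) (by omega)
      rw [show l + 1 + (j - 1) = l + j by omega] at this
      exact (hb _).resolve_right this

end recover

/-! ### Square coordinates as heights in the trapezoid -/

section trapezoid

variable {N : ℕ}

theorem height_zero (p : ℂ) : height N 0 p = p.im := by simp [height]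

theorem height_zero_toTrapezoid (z : ℝ × ℝ) : height N 0 (toTrapezoid N z) = z.1 := by
  simp [height, toTrapezoid]

theorem height_one_toTrapezoid (hN : 2 ≤ N) (z : ℝ × ℝ) :
    height N 1 (toTrapezoid N z) = z.2 := by
  have := (sin_angle_pos hN).ne'
  simp [height, toTrapezoid]
  field_simp; ring

theorem ext_height (hN : 2 ≤ N) {p q : ℂ} (h0 : height N 0 p = height N 0 q)
    (h1 : height N 1 p = height N 1 q) : p = q := by
  have := (sin_angle_pos hN).ne'
  simp only [height_zero] at h0
  simp only [height, one_mul, h0] at h1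
  refine Complex.ext ?_ h0
  apply mul_right_cancel₀ this
  linarith

theorem toTrapezoid_add (z w : ℝ × ℝ) :
    toTrapezoid N (z + w) = toTrapezoid N z + toTrapezoid N w := by
  apply Complex.ext <;> (simp [toTrapezoid]; try ring)

theorem toTrapezoid_sub (z w : ℝ × ℝ) :
    toTrapezoid N (z - w) = toTrapezoid N z - toTrapezoid N w := by
  apply Complex.ext <;> (simp [toTrapezoid]; try ring)

theorem toTrapezoid_neg (z : ℝ × ℝ) : toTrapezoid N (-z) = -toTrapezoid N z := by
  apply Complex.ext <;> (simp [toTrapezoid]; try ring)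

theorem toTrapezoid_smul (r : ℝ) (z : ℝ × ℝ) : toTrapezoid N (r • z) = r • toTrapezoid N z := by
  apply Complex.ext <;> (simp [toTrapezoid]; try ring)

theorem toTrapezoid_injective (hN : 2 ≤ N) : Function.Injective (toTrapezoid N) := by
  intro z w h
  have h0 := congrArg (height N 0) h
  have h1 := congrArg (height N 1) h
  simp only [height_zero_toTrapezoid, height_one_toTrapezoid hN] at h0 h1
  exact Prod.ext h0 h1

theorem toTrapezoid_heights (hN : 2 ≤ N) (p : ℂ) :
    toTrapezoid N (height N 0 p, height N 1 p) = p :=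
  ext_height hN (by rw [height_zero_toTrapezoid]) (by rw [height_one_toTrapezoid hN])

theorem height_toTrapezoid_add_two (n : ℕ) (p : ℂ) : height N ((n + 2 : ℕ) : ℝ) p =
    2 * Real.cos (angle N) * height N ((n + 1 : ℕ) : ℝ) p - height N n p := by
  push_cast; exact height_add_two _ _

end trapezoid

/-! ### Orbits of the filter as bounded forced recurrences -/

section filter

variable {N : ℕ}

/-- Membership in the open square, in terms of absolute values. -/
theorem mem_square {z : ℝ × ℝ} :
    z ∈ Set.Ioo (-1 : ℝ) 1 ×ˢ Set.Ioo (-1 : ℝ) 1 ↔ |z.1| < 1 ∧ |z.2| < 1 := by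
  simp only [Set.mem_prod, Set.mem_Ioo, abs_lt]

theorem abs_accum_lt (hN : 2 ≤ N) {z : ℝ × ℝ} (h1 : |z.1| < 1) (h2 : |z.2| < 1) :
    |accum N z| < 3 := by
  have c0 := cos_angle_nonneg hN
  have c1 := Real.cos_le_one (angle N)
  rw [abs_lt] at *
  unfold accum
  constructor <;> nlinarith

theorem sawtooth_accum {z : ℝ × ℝ} (h : |accum N z| < 3) :
    sawtooth (accum N z) = accum N z - 2 * symb N z := by
  rw [abs_lt] at h
  unfold sawtooth symb
  split_ifs with h1 h2
  · have : ⌊(accum N z + 1) / 2⌋ = 1 := by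
      rw [Int.floor_eq_iff]; push_cast; constructor <;> linarith
    rw [Int.fract, this]; push_cast; ring
  · have : ⌊(accum N z + 1) / 2⌋ = -1 := by
      rw [Int.floor_eq_iff]; push_cast; constructor <;> linarith
    rw [Int.fract, this]; push_cast; ring
  · have : ⌊(accum N z + 1) / 2⌋ = 0 := by
      rw [Int.floor_eq_iff]; push_cast; push Not at h1 h2; constructor <;> linarith
    rw [Int.fract, this]; push_cast; ring

theorem symb_cases (z : ℝ × ℝ) : symb N z = 0 ∨ symb N z = 1 ∨ symb N z = -1 := by
  unfold symb; split_ifs <;> simp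

/-- Two shifts by different even integers cannot both bring the accumulator into an interval of
length `2`; thus boundedness alone identifies the symbols. -/
theorem symb_eq_of_abs_lt {z : ℝ × ℝ} {s : ℤ} (h : |accum N z| < 3)
    (hs : |accum N z - 2 * s| < 1) : symb N z = s := by
  rw [abs_lt] at h hs
  have b1 : (s : ℝ) < 2 := by linarith
  have b2 : (-2 : ℝ) < s := by linarith
  have b1' : s < 2 := by exact_mod_cast b1
  have b2' : -2 < s := by exact_mod_cast b2
  unfold symb
  split_ifs with h1 h2
  · have : (0 : ℝ) < s := by linarith
    have : 0 < s := by exact_mod_cast this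
    omega
  · have : (s : ℝ) < 0 := by linarith
    have : s < 0 := by exact_mod_cast this
    omega
  · push Not at h1 h2
    have c1 : (s : ℝ) < 1 := by linarith
    have c2 : (-1 : ℝ) < s := by linarith
    have c1' : s < 1 := by exact_mod_cast c1
    have c2' : -1 < s := by exact_mod_cast c2
    omega

theorem iterate_succ_fst (n : ℕ) (z : ℝ × ℝ) :
    ((Df N)^[n + 1] z).1 = ((Df N)^[n] z).2 := by
  rw [Function.iterate_succ_apply']; rfl

theorem mem_DfRegular_iff {z : ℝ × ℝ} :
    z ∈ DfRegular N ↔ ∀ n, |((Df N)^[n] z).1| < 1 := by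
  refine ⟨fun h n => (mem_square.1 (h n)).1, fun h n => mem_square.2 ⟨h n, ?_⟩⟩
  rw [← iterate_succ_fst]; exact h _

theorem DfRegular.iterate {z : ℝ × ℝ} (hz : z ∈ DfRegular N) (n : ℕ) :
    (Df N)^[n] z ∈ DfRegular N := by
  intro m
  rw [← Function.iterate_add_apply]; exact hz _

theorem DfRegular.recurrence (hN : 2 ≤ N) {z : ℝ × ℝ} (hz : z ∈ DfRegular N) (n : ℕ) :
    ((Df N)^[n + 2] z).1 = 2 * Real.cos (angle N) * ((Df N)^[n + 1] z).1 - ((Df N)^[n] z).1 -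
      2 * symb N ((Df N)^[n] z) := by
  obtain ⟨h1, h2⟩ := mem_square.1 (hz n)
  rw [show n + 2 = n + 1 + 1 from rfl, iterate_succ_fst, iterate_succ_fst,
    Function.iterate_succ_apply']
  change sawtooth (accum N _) = _
  rw [sawtooth_accum (abs_accum_lt hN h1 h2)]
  unfold accum; ring

/-- A bounded scalar sequence with the recurrence of the filter comes from an orbit. -/
theorem iterate_of_recurrence (hN : 2 ≤ N) {X : ℕ → ℝ} {s : ℕ → ℤ} (h1 : ∀ n, |X n| < 1)
    (hX : ∀ n, X (n + 2) = 2 * Real.cos (angle N) * X (n + 1) - X n - 2 * s n) (n : ℕ) :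
    (Df N)^[n] (X 0, X 1) = (X n, X (n + 1)) ∧ symb N ((Df N)^[n] (X 0, X 1)) = s n := by
  have hs : ∀ n, symb N (X n, X (n + 1)) = s n := by
    intro n
    refine symb_eq_of_abs_lt (abs_accum_lt hN (h1 n) (h1 (n + 1))) ?_
    have := h1 (n + 2)
    rw [hX n] at this
    convert this using 2
    unfold accum; ring
  have key : ∀ n, (Df N)^[n] (X 0, X 1) = (X n, X (n + 1)) := by
    intro n
    induction n with
    | zero => rfl
    | succ n ih =>
      rw [Function.iterate_succ_apply', ih]
      refine Prod.ext rfl ?_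
      change sawtooth (accum N _) = X (n + 2)
      rw [sawtooth_accum (abs_accum_lt hN (h1 n) (h1 (n + 1))), hs, hX]
      unfold accum; ring
  exact ⟨key n, by rw [key n, hs]⟩

theorem DfRegular.of_recurrence (hN : 2 ≤ N) {X : ℕ → ℝ} {s : ℕ → ℤ} (h1 : ∀ n, |X n| < 1)
    (hX : ∀ n, X (n + 2) = 2 * Real.cos (angle N) * X (n + 1) - X n - 2 * s n) :
    (X 0, X 1) ∈ DfRegular N := by
  rw [mem_DfRegular_iff]
  intro n
  rw [(iterate_of_recurrence hN h1 hX n).1]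
  exact h1 n

/-- The sawtooth is not odd at its jumps, but the negated orbit is a bounded solution of the
recurrence with negated symbols, hence an orbit. -/
theorem DfRegular.neg_aux (hN : 2 ≤ N) {z : ℝ × ℝ} (hz : z ∈ DfRegular N) :
    -z ∈ DfRegular N ∧ ∀ n, (Df N)^[n] (-z) = -(Df N)^[n] z ∧
      symb N ((Df N)^[n] (-z)) = -symb N ((Df N)^[n] z) := by
  have h1 : ∀ n, |(fun n => -((Df N)^[n] z).1) n| < 1 := by
    intro n; rw [abs_neg]; exact mem_DfRegular_iff.1 hz n
  have hX : ∀ n, (fun n => -((Df N)^[n] z).1) (n + 2) = 2 * Real.cos (angle N) *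
      (fun n => -((Df N)^[n] z).1) (n + 1) - (fun n => -((Df N)^[n] z).1) n -
      2 * ((fun n => -symb N ((Df N)^[n] z)) n : ℤ) := by
    intro n
    have := DfRegular.recurrence hN hz n
    simp only [this]; push_cast; ring
  have e : (-((Df N)^[0] z).1, -((Df N)^[1] z).1) = -z := rfl
  refine ⟨?_, fun n => ?_⟩
  · rw [← e]; exact DfRegular.of_recurrence hN h1 hX
  · have := iterate_of_recurrence hN h1 hX n
    simp only [e] at this
    refine ⟨?_, this.2⟩
    rw [this.1, iterate_succ_fst]; rfl

theorem DfRegular.neg (hN : 2 ≤ N) {z : ℝ × ℝ} (hz : z ∈ DfRegular N) : -z ∈ DfRegular N :=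
  (DfRegular.neg_aux hN hz).1

theorem DfRegular.iterate_neg (hN : 2 ≤ N) {z : ℝ × ℝ} (hz : z ∈ DfRegular N) (n : ℕ) :
    (Df N)^[n] (-z) = -(Df N)^[n] z := ((DfRegular.neg_aux hN hz).2 n).1

theorem DfRegular.symb_iterate_neg (hN : 2 ≤ N) {z : ℝ × ℝ} (hz : z ∈ DfRegular N) (n : ℕ) :
    symb N ((Df N)^[n] (-z)) = -symb N ((Df N)^[n] z) := ((DfRegular.neg_aux hN hz).2 n).2

theorem mem_DfCell_self {z : ℝ × ℝ} (hz : z ∈ DfRegular N) : z ∈ DfCell N z := ⟨hz, fun _ => rfl⟩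

theorem DfCell_eq_of_mem {z w : ℝ × ℝ} (hw : w ∈ DfCell N z) : DfCell N w = DfCell N z := by
  ext v
  exact and_congr_right fun _ => forall_congr' fun n => by rw [hw.2 n]

theorem iterate_mem_DfCell {z w : ℝ × ℝ} (hw : w ∈ DfCell N z) (n : ℕ) :
    (Df N)^[n] w ∈ DfCell N ((Df N)^[n] z) := by
  refine ⟨DfRegular.iterate hw.1 n, fun m => ?_⟩
  rw [← Function.iterate_add_apply, ← Function.iterate_add_apply]; exact hw.2 _

/-- On a region the iterates of `Df` are affine. -/
theorem iterate_fst_of_mem_DfCell (hN : 2 ≤ N) {z w : ℝ × ℝ} (hz : z ∈ DfRegular N)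
    (hw : w ∈ DfCell N z) (n : ℕ) :
    ((Df N)^[n] w).1 = ((Df N)^[n] z).1 + height N n (toTrapezoid N w - toTrapezoid N z) := by
  rw [← toTrapezoid_sub]
  have key : ∀ n : ℕ,
      ((Df N)^[n] w).1 = ((Df N)^[n] z).1 + height N n (toTrapezoid N (w - z)) ∧
      ((Df N)^[n + 1] w).1 =
        ((Df N)^[n + 1] z).1 + height N (n + 1 : ℕ) (toTrapezoid N (w - z)) := by
    intro n
    induction n with
    | zero =>
      constructor
      · simp [height_zero_toTrapezoid]
      · rw [iterate_succ_fst, iterate_succ_fst, zero_add, Nat.cast_one, height_one_toTrapezoid hN]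
        simp
    | succ n ih =>
      refine ⟨ih.2, ?_⟩
      rw [DfRegular.recurrence hN hw.1, DfRegular.recurrence hN hz, ih.1, ih.2, hw.2 n,
        height_toTrapezoid_add_two]
      ring
  exact (key n).1

/-- A bounded solution driven by the symbols of `z` is automatically an orbit with those symbols.
The region is therefore an intersection of open strips, which yields its convexity and, for periodic
`z`, its openness. -/
theorem mem_DfCell_iff (hN : 2 ≤ N) {z w : ℝ × ℝ} (hz : z ∈ DfRegular N) :
    w ∈ DfCell N z ↔ ∀ n : ℕ,
      |((Df N)^[n] z).1 + height N n (toTrapezoid N w - toTrapezoid N z)| < 1 := by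
  constructor
  · intro hw n
    rw [← iterate_fst_of_mem_DfCell hN hz hw]
    exact mem_DfRegular_iff.1 hw.1 n
  · intro h
    set X : ℕ → ℝ := fun n =>
      ((Df N)^[n] z).1 + height N n (toTrapezoid N w - toTrapezoid N z) with hXd
    have hX : ∀ n, X (n + 2) = 2 * Real.cos (angle N) * X (n + 1) - X n -
        2 * ((fun n => symb N ((Df N)^[n] z)) n : ℤ) := by
      intro n
      simp only [hXd]
      rw [DfRegular.recurrence hN hz, height_toTrapezoid_add_two]
      ring
    have e : (X 0, X 1) = w := by
      simp only [hXd, Nat.cast_zero, Nat.cast_one]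
      rw [← toTrapezoid_sub, height_zero_toTrapezoid, height_one_toTrapezoid hN, iterate_succ_fst]
      simp
    have h1 := DfRegular.of_recurrence hN h hX
    have h2 := fun n => (iterate_of_recurrence hN h hX n).2
    rw [e] at h1 h2
    exact ⟨h1, h2⟩

theorem toTrapezoid_iterate (hN : 2 ≤ N) {z w : ℝ × ℝ} (hz : z ∈ DfRegular N)
    (hw : w ∈ DfCell N z) (n : ℕ) :
    toTrapezoid N ((Df N)^[n] w) = toTrapezoid N ((Df N)^[n] z) +
      rot N (-n) * (toTrapezoid N w - toTrapezoid N z) := by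
  apply ext_height hN
  · rw [height_zero_toTrapezoid, height_add, height_zero_toTrapezoid, height_rot_mul,
      iterate_fst_of_mem_DfCell hN hz hw]
    simp
  · rw [height_one_toTrapezoid hN, height_add, height_one_toTrapezoid hN, height_rot_mul,
      ← iterate_succ_fst, ← iterate_succ_fst, iterate_fst_of_mem_DfCell hN hz hw]
    push_cast; ring_nf

end filter

/-! ### Centroids under affine maps and in convex sets -/

section center

variable {E F : Type*} [NormedAddCommGroup E] [NormedSpace ℝ E] [MeasureSpace E] [BorelSpace E]
  [FiniteDimensional ℝ E] [(volume : Measure E).IsAddHaarMeasure]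
  [NormedAddCommGroup F] [NormedSpace ℝ F] [MeasureSpace F] [BorelSpace F]
  [FiniteDimensional ℝ F] [(volume : Measure F).IsAddHaarMeasure]

/-- The centroid is equivariant under affine isomorphisms. -/
theorem center_image_affine (L : E ≃ₗ[ℝ] F) (v : F) {U : Set E} (hU : IsOpen U)
    (hne : U.Nonempty) (hb : Bornology.IsBounded U) :
    center ((fun x => L x + v) '' U) = L (center U) + v := by
  set e : E ≃L[ℝ] F := L.toContinuousLinearEquiv
  have he : ∀ x, e x = L x := fun _ => rfl
  set f : E ≃ₜ F := e.toHomeomorph.trans (Homeomorph.addRight v)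
  have hf : ∀ x, f x = L x + v := fun _ => rfl
  have hfe : (fun x => L x + v) = f := rfl
  -- By uniqueness of Haar measure the pushforward is a multiple of the volume; the factor cancels
  -- in the average.
  obtain ⟨c, hc0, hc⟩ : ∃ c : NNReal, c ≠ 0 ∧ Measure.map f volume = c • (volume : Measure F) := by
    have : SecondCountableTopology F := inferInstance
    have h1 := e.isAddHaarMeasure_map (volume : Measure E)
    refine ⟨Measure.addHaarScalarFactor (Measure.map e volume) volume,
      (Measure.addHaarScalarFactor_pos_of_isAddHaarMeasure _ _).ne', ?_⟩
    have h2 := Measure.isAddLeftInvariant_eq_smul (Measure.map e (volume : Measure E)) volume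
    have h3 : Measure.map f volume = Measure.map (fun x => x + v) (Measure.map e volume) := by
      rw [Measure.map_map (by fun_prop) (by fun_prop)]; rfl
    rw [h3, ← h2, (measurePreserving_add_right _ v).map_eq]
  have hmp : MeasurePreserving f (volume : Measure E) (c • (volume : Measure F)) :=
    ⟨f.measurable, hc⟩
  have hvol : volume U = c • volume (f '' U) := by
    have := hmp.measure_preimage_emb f.measurableEmbedding (f '' U)
    rw [f.preimage_image] at this
    simpa using this
  have hint : ∫ x in U, f x = (c : ℝ) • ∫ y in f '' U, y := by
    have := hmp.setIntegral_image_emb f.measurableEmbedding (fun y => y) U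
    rw [← this, Measure.restrict_smul, integral_smul_nnreal_measure]; rfl
  have hfin : volume U ≠ ⊤ := hb.measure_lt_top.ne
  have hpos : 0 < volume.real U :=
    ENNReal.toReal_pos (hU.measure_pos volume hne).ne' hfin
  have hreal : volume.real U = c * volume.real (f '' U) := by
    simp [measureReal_def, hvol]
  have hI : IntegrableOn (fun x : E => L x) U := by
    obtain ⟨R, hR⟩ := hb.subset_closedBall 0
    have : IntegrableOn (fun x : E => e x) (Metric.closedBall 0 R) :=
      e.continuous.continuousOn.integrableOn_compact (isCompact_closedBall 0 R)
    exact this.mono_set hR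
  have hsplit : ∫ x in U, f x = L (∫ x in U, x) + volume.real U • v := by
    simp only [hf]
    have h3 : IntegrableOn (fun _ : E => v) U := integrableOn_const hfin
    rw [integral_add hI h3, setIntegral_const]
    congr 1
    exact e.integral_comp_comm (fun x => x)
  have hc0' : (c : ℝ) ≠ 0 := by exact_mod_cast hc0
  rw [hfe, center, center, setAverage_eq, setAverage_eq, map_smul]
  have h4 : (∫ y in f '' U, y) = (c : ℝ)⁻¹ • (L (∫ x in U, x) + volume.real U • v) := by
    rw [← hsplit, hint, smul_smul, inv_mul_cancel₀ hc0', one_smul]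
  have h5 : volume.real (f '' U) = (c : ℝ)⁻¹ * volume.real U := by
    rw [hreal, ← mul_assoc, inv_mul_cancel₀ hc0', one_mul]
  rw [h4, h5, smul_smul, smul_add, smul_smul]
  congr 1
  · congr 1; field_simp
  · rw [show ((c : ℝ)⁻¹ * volume.real U)⁻¹ * (c : ℝ)⁻¹ * volume.real U = 1 by
      field_simp, one_smul]

/-- The average over a closed ball inside `U` stays in the ball, hence in the interior of `U`;
convexity then keeps the average over all of `U` in the interior. -/
theorem center_mem {U : Set E} (hU : IsOpen U) (hc : Convex ℝ U) (hne : U.Nonempty)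
    (hb : Bornology.IsBounded U) : center U ∈ U := by
  obtain ⟨x, hx⟩ := hne
  obtain ⟨r, hr, hxr⟩ := Metric.nhds_basis_closedBall.mem_iff.1 (hU.mem_nhds hx)
  have hfin : volume U ≠ ⊤ := hb.measure_lt_top.ne
  have : IsFiniteMeasure ((volume : Measure E).restrict U) :=
    ⟨by rw [Measure.restrict_apply_univ]; exact hfin.lt_top⟩
  have hsub : (Metric.closedBall x r) ∩ U = Metric.closedBall x r :=
    Set.inter_eq_left.2 hxr
  have hball : (volume : Measure E) (Metric.closedBall x r) ≠ 0 :=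
    (Metric.measure_closedBall_pos volume x hr).ne'
  have hI : IntegrableOn (fun x : E => x) U := by
    obtain ⟨R, hR⟩ := hb.subset_closedBall 0
    have : IntegrableOn (fun x : E => x) (Metric.closedBall 0 R) :=
      continuous_id.continuousOn.integrableOn_compact (isCompact_closedBall 0 R)
    exact this.mono_set hR
  have hmem := hc.average_mem_interior_of_set (μ := (volume : Measure E).restrict U)
    (f := fun x => x) (t := Metric.closedBall x r) ?_ (ae_restrict_mem hU.measurableSet) hI ?_
  · exact interior_subset hmem
  · rw [Measure.restrict_apply Metric.isClosed_closedBall.measurableSet, hsub]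
    exact hball
  · rw [Measure.restrict_restrict Metric.isClosed_closedBall.measurableSet, hsub, hU.interior_eq]
    exact hxr ((convex_closedBall x r).set_average_mem Metric.isClosed_closedBall hball
      measure_closedBall_lt_top.ne (ae_restrict_mem Metric.isClosed_closedBall.measurableSet)
      (hI.mono_set hxr))

end center

/-! ### Geometry and periodicity of the regions of `Df` -/

section cells

variable {N : ℕ}

/-- The linear isomorphism from the square to the rotated trapezoid. -/
noncomputable def trapezoidEquiv (hN : 2 ≤ N) (u : ℝ) : (ℝ × ℝ) ≃ₗ[ℝ] ℂ :=
  LinearEquiv.ofBijective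
    { toFun := fun w => rot N u * toTrapezoid N w
      map_add' := fun z w => by rw [toTrapezoid_add, mul_add]
      map_smul' := fun r z => by
        rw [toTrapezoid_smul, RingHom.id_apply, mul_smul_comm] }
    ⟨fun _ _ h => toTrapezoid_injective hN (mul_left_cancel₀ (rot_ne_zero u) h),
      fun p => ⟨_, show rot N u * toTrapezoid N (height N 0 (rot N (-u) * p),
        height N 1 (rot N (-u) * p)) = p by
          rw [toTrapezoid_heights hN, ← mul_assoc, rot_mul_rot_neg, one_mul]⟩⟩

theorem trapezoidEquiv_apply (hN : 2 ≤ N) (u : ℝ) (w : ℝ × ℝ) :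
    trapezoidEquiv hN u w = rot N u * toTrapezoid N w := rfl

/-- After one period of `z` the displacement from `z` has turned by `-lθ`; after `2N` periods it has
turned fully. -/
theorem isPeriodicPt_of_mem_DfCell (hN : 2 ≤ N) {z w : ℝ × ℝ} {l : ℕ} (hz : z ∈ DfRegular N)
    (hl : Function.IsPeriodicPt (Df N) l z) (hw : w ∈ DfCell N z) :
    Function.IsPeriodicPt (Df N) (l * (2 * N)) w := by
  have h1 := toTrapezoid_iterate hN hz hw (l * (2 * N))
  have h2 : (Df N)^[l * (2 * N)] z = z := hl.mul_const _
  rw [h2, show (-((l * (2 * N) : ℕ) : ℝ)) = ((-l : ℤ) : ℝ) * (2 * N) by push_cast; ring,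
    rot_int_mul hN] at h1
  apply toTrapezoid_injective hN
  rw [h1]; ring

theorem image_iterate_DfCell (hN : 2 ≤ N) {z : ℝ × ℝ} (hz : z ∈ DfRegular N)
    (hp : z ∈ Function.periodicPts (Df N)) (n : ℕ) :
    (Df N)^[n] '' DfCell N z = DfCell N ((Df N)^[n] z) := by
  apply Set.Subset.antisymm
  · rintro _ ⟨w, hw, rfl⟩
    exact iterate_mem_DfCell hw n
  · intro v hv
    obtain ⟨l, hl0, hl⟩ := hp
    have hq : 1 ≤ l * (2 * N) := Nat.mul_pos hl0 (by omega)
    have hvp := isPeriodicPt_of_mem_DfCell hN (DfRegular.iterate hz n) (hl.apply_iterate n) hv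
    -- A multiple of the common period that is at least `n`: the preimage of `v` is found by
    -- completing the cycle.
    have hle : n ≤ l * (2 * N) * n := by nlinarith
    refine ⟨(Df N)^[l * (2 * N) * n - n] v, ?_, ?_⟩
    · have := iterate_mem_DfCell hv (l * (2 * N) * n - n)
      rw [← Function.iterate_add_apply, Nat.sub_add_cancel hle] at this
      rwa [((hl.mul_const (2 * N)).mul_const n).eq] at this
    · rw [← Function.iterate_add_apply, Nat.add_sub_cancel' hle]
      exact hvp.mul_const n

theorem image_neg_DfCell (hN : 2 ≤ N) {z : ℝ × ℝ} (hz : z ∈ DfRegular N) :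
    (fun w => -w) '' DfCell N z = DfCell N (-z) := by
  have key : ∀ {z : ℝ × ℝ}, z ∈ DfRegular N → ∀ w ∈ DfCell N z, -w ∈ DfCell N (-z) := by
    intro z hz w hw
    refine ⟨DfRegular.neg hN hw.1, fun n => ?_⟩
    rw [DfRegular.symb_iterate_neg hN hw.1, DfRegular.symb_iterate_neg hN hz, hw.2]
  apply Set.Subset.antisymm
  · rintro _ ⟨w, hw, rfl⟩
    exact key hz w hw
  · intro v hv
    refine ⟨-v, ?_, neg_neg v⟩
    simpa using key (DfRegular.neg hN hz) v hv

theorem continuous_toTrapezoid : Continuous (toTrapezoid N) := by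
  have : toTrapezoid N = fun z : ℝ × ℝ => Complex.I * (((z.1 : ℝ) : ℂ) +
      ((-z.1 * (Real.cos (angle N) / Real.sin (angle N)) + z.2 / Real.sin (angle N) : ℝ) : ℂ) *
        Complex.I) := by
    funext z
    simp only [toTrapezoid, Complex.mk_eq_add_mul_I]
  rw [this]
  fun_prop

theorem continuous_height (u : ℝ) : Continuous (height N u) := by
  unfold height; fun_prop

theorem convex_DfCell (hN : 2 ≤ N) {z : ℝ × ℝ} (hz : z ∈ DfRegular N) :
    Convex ℝ (DfCell N z) := by
  intro v hv w hw a b ha hb hab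
  rw [mem_DfCell_iff hN hz] at *
  intro n
  have h1 := abs_lt.1 (hv n)
  have h2 := abs_lt.1 (hw n)
  have e : ((Df N)^[n] z).1 + height N n (toTrapezoid N (a • v + b • w) - toTrapezoid N z) =
      a * (((Df N)^[n] z).1 + height N n (toTrapezoid N v - toTrapezoid N z)) +
      b * (((Df N)^[n] z).1 + height N n (toTrapezoid N w - toTrapezoid N z)) := by
    have hs : ∀ (r : ℝ) p, height N n (r • p) = r * height N n p := by
      intro r p; simp [height]; ring
    rw [toTrapezoid_add, toTrapezoid_smul, toTrapezoid_smul]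
    simp only [height_sub, height_add, hs]
    linear_combination (height N n (toTrapezoid N z) - ((Df N)^[n] z).1) * hab
  rw [e, abs_lt]
  rcases ha.eq_or_lt with rfl | ha
  · have : b = 1 := by linarith
    subst this
    constructor <;> linarith
  · constructor <;> nlinarith

theorem isOpen_DfCell (hN : 2 ≤ N) {z : ℝ × ℝ} (hz : z ∈ DfRegular N)
    (hp : z ∈ Function.periodicPts (Df N)) : IsOpen (DfCell N z) := by
  obtain ⟨l, hl0, hl⟩ := hp
  have hq : 0 < l * (2 * N) := Nat.mul_pos hl0 (by omega)
  -- The strips repeat with period `l * (2 * N)`, so finitely many of them cut out the region.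
  have hX : ∀ w n, ((Df N)^[n % (l * (2 * N))] z).1 +
      height N (n % (l * (2 * N)) : ℕ) (toTrapezoid N w - toTrapezoid N z) =
      ((Df N)^[n] z).1 + height N n (toTrapezoid N w - toTrapezoid N z) := by
    intro w n
    have h1 : (Df N)^[n % (l * (2 * N))] z = (Df N)^[n] z := (hl.mul_const (2 * N)).iterate_mod_apply n
    have h2 : rot N (-n) = rot N (-(n % (l * (2 * N)) : ℕ)) := by
      have h3 : (-(n : ℝ)) = -(n % (l * (2 * N)) : ℕ) +
          ((-(l * (n / (l * (2 * N))) : ℕ) : ℤ) : ℝ) * (2 * N) := by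
        conv_lhs => rw [← Nat.mod_add_div n (l * (2 * N))]
        generalize n / (l * (2 * N)) = d
        generalize n % (l * (2 * N)) = r
        push_cast; ring
      rw [h3, rot_add, rot_int_mul hN, mul_one]
    have h4 : ∀ p, height N n p = height N (n % (l * (2 * N)) : ℕ) p := by
      intro p
      have h5 := height_rot_mul (N := N) 0 (-n) p
      have h6 := height_rot_mul (N := N) 0 (-(n % (l * (2 * N)) : ℕ)) p
      rw [zero_sub, neg_neg] at h5 h6
      rw [← h5, ← h6, h2]
    rw [h1, h4]
  have : DfCell N z = ⋂ n ∈ Finset.range (l * (2 * N)),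
      {w | |((Df N)^[n] z).1 + height N n (toTrapezoid N w - toTrapezoid N z)| < 1} := by
    ext w
    rw [mem_DfCell_iff hN hz]
    simp only [Set.mem_iInter, Set.mem_ofPred_eq, Finset.mem_range]
    refine ⟨fun h n _ => h n, fun h n => ?_⟩
    rw [← hX]
    exact h _ (Nat.mod_lt _ hq)
  rw [this]
  refine isOpen_biInter_finset fun n _ => isOpen_lt ?_ continuous_const
  exact (continuous_const.add ((continuous_height n).comp
    (continuous_toTrapezoid.sub continuous_const))).abs

theorem isBounded_DfCell (z : ℝ × ℝ) : Bornology.IsBounded (DfCell N z) := by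
  refine (Metric.isBounded_closedBall (x := (0 : ℝ × ℝ)) (r := 1)).subset fun w hw => ?_
  obtain ⟨h1, h2⟩ := mem_square.1 (hw.1 0)
  rw [mem_closedBall_zero_iff, Prod.norm_def]
  exact max_le h1.le h2.le

theorem center_DfCell_mem (hN : 2 ≤ N) {z : ℝ × ℝ} (hz : z ∈ DfRegular N)
    (hp : z ∈ Function.periodicPts (Df N)) : center (DfCell N z) ∈ DfCell N z :=
  center_mem (isOpen_DfCell hN hz hp) (convex_DfCell hN hz) ⟨z, mem_DfCell_self hz⟩
    (isBounded_DfCell z)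

theorem center_image_DfCell (hN : 2 ≤ N) {z : ℝ × ℝ} (hz : z ∈ DfRegular N)
    (hp : z ∈ Function.periodicPts (Df N)) (n : ℕ) :
    center (DfCell N ((Df N)^[n] z)) = (Df N)^[n] (center (DfCell N z)) := by
  set c := center (DfCell N z) with hc
  -- The rotation by `-nθ` in square coordinates, which is the linear part of the `n`-th iterate on
  -- the region.
  set f : (ℝ × ℝ) ≃ₗ[ℝ] (ℝ × ℝ) := (trapezoidEquiv hN (-n)).trans (trapezoidEquiv hN 0).symm
  have hf : ∀ w ∈ DfCell N z, (Df N)^[n] w = f w + ((Df N)^[n] z - f z) := by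
    intro w hw
    have h1 := toTrapezoid_iterate hN hz hw n
    apply (trapezoidEquiv hN 0).injective
    simp only [map_add, map_sub, f, LinearEquiv.trans_apply, LinearEquiv.apply_symm_apply]
    simp only [trapezoidEquiv_apply, rot_zero, one_mul, h1]
    ring
  rw [← image_iterate_DfCell hN hz hp, hf c (center_DfCell_mem hN hz hp), Set.image_congr hf,
    center_image_affine _ _ (isOpen_DfCell hN hz hp) ⟨z, mem_DfCell_self hz⟩ (isBounded_DfCell z)]

theorem center_DfCell_neg (hN : 2 ≤ N) {z : ℝ × ℝ} (hz : z ∈ DfRegular N)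
    (hp : z ∈ Function.periodicPts (Df N)) :
    center (DfCell N (-z)) = -center (DfCell N z) := by
  have := center_image_affine (LinearEquiv.neg ℝ (M := ℝ × ℝ)) 0 (isOpen_DfCell hN hz hp)
    ⟨z, mem_DfCell_self hz⟩ (isBounded_DfCell z)
  simp only [LinearEquiv.neg_apply, add_zero] at this
  rw [← image_neg_DfCell hN hz, this]

end cells

/-! ### The mode: alternation of overflow and underflow -/

/-- A regular periodic point some of whose symbols do not vanish. -/
def Live (N : ℕ) (z : ℝ × ℝ) : Prop :=
  z ∈ DfRegular N ∧ z ∈ Function.periodicPts (Df N) ∧ ∃ n, symb N ((Df N)^[n] z) ≠ 0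

/-- The first symbol that does not vanish is an underflow. -/
def UnderflowNext (N : ℕ) (z : ℝ × ℝ) : Prop :=
  ∃ m, symb N ((Df N)^[m] z) = -1 ∧ ∀ i < m, symb N ((Df N)^[i] z) = 0

open Classical in
/-- The accumulated overflow of a point: `1` between an overflow and the following underflow,
`0` between an underflow and the following overflow. -/
noncomputable def mode (N : ℕ) (z : ℝ × ℝ) : ℤ := if UnderflowNext N z then 1 else 0

/-- The point of Tangent space that belongs to a point of the square. -/
noncomputable def tangentMap (N : ℕ) (b : ℤ) (w : ℝ × ℝ) : ℂ :=
  toTrapezoid N (w.1 - 2 * b, w.2)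

/-- The point of Tangent space that belongs to a point of the square, with its own mode. -/
noncomputable def tangentPt (N : ℕ) (z : ℝ × ℝ) : ℂ := tangentMap N (mode N z) z

section mode

variable {N : ℕ}

theorem iterate_iterate_Df (z : ℝ × ℝ) (n : ℕ) : (Df N)^[n] (Df N z) = (Df N)^[n + 1] z :=
  (Function.iterate_succ_apply _ _ _).symm

theorem mem_periodicPts_iterate {α : Type*} {f : α → α} {x : α} (h : x ∈ Function.periodicPts f)
    (n : ℕ) : f^[n] x ∈ Function.periodicPts f := by
  obtain ⟨l, h0, hl⟩ := h
  exact ⟨l, h0, hl.apply_iterate n⟩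

theorem exists_iterate_iterate_eq {α : Type*} {f : α → α} {x : α}
    (h : x ∈ Function.periodicPts f) (n : ℕ) : ∃ m, f^[m] (f^[n] x) = x := by
  obtain ⟨l, h0, hl⟩ := h
  have hle : n ≤ l * n := Nat.le_mul_of_pos_left n h0
  refine ⟨l * n - n, ?_⟩
  rw [← Function.iterate_add_apply, Nat.sub_add_cancel hle]
  exact hl.mul_const n

theorem Live.iterate {z : ℝ × ℝ} (hz : Live N z) (n : ℕ) : Live N ((Df N)^[n] z) := by
  obtain ⟨h1, h2, m, hm⟩ := hz
  refine ⟨DfRegular.iterate h1 n, mem_periodicPts_iterate h2 n, ?_⟩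
  obtain ⟨i, hi⟩ := exists_iterate_iterate_eq h2 n
  refine ⟨m + i, ?_⟩
  rwa [Function.iterate_add_apply, hi]

theorem Live.map {z : ℝ × ℝ} (hz : Live N z) : Live N (Df N z) := hz.iterate 1

theorem Live.neg (hN : 2 ≤ N) {z : ℝ × ℝ} (hz : Live N z) : Live N (-z) := by
  obtain ⟨h1, ⟨l, hl0, hl⟩, m, hm⟩ := hz
  refine ⟨DfRegular.neg hN h1, ⟨l, hl0, ?_⟩, m, ?_⟩
  · change (Df N)^[l] (-z) = -z
    rw [DfRegular.iterate_neg hN h1, hl.eq]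
  · rw [DfRegular.symb_iterate_neg hN h1]
    exact neg_ne_zero.2 hm

theorem Live.of_mem (hN : 2 ≤ N) {z w : ℝ × ℝ} (hz : Live N z) (hw : w ∈ DfCell N z) :
    Live N w := by
  obtain ⟨h1, ⟨l, hl0, hl⟩, m, hm⟩ := hz
  refine ⟨hw.1, ⟨_, Nat.mul_pos hl0 (show 0 < 2 * N by omega),
    isPeriodicPt_of_mem_DfCell hN h1 hl hw⟩, m, ?_⟩
  rwa [hw.2]

/-- After an overflow the next symbol that does not vanish is not an overflow. -/
theorem symb_ne_one_of_overflow (hN : 2 ≤ N) {z : ℝ × ℝ} (hz : z ∈ DfRegular N)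
    (h1 : symb N z = 1) {m : ℕ} (hm : ∀ i < m, symb N ((Df N)^[i + 1] z) = 0) :
    symb N ((Df N)^[m + 1] z) ≠ 1 := by
  intro hcon
  set x : ℕ → ℝ := fun n => ((Df N)^[n] z).1 with hx
  have hx1 : ∀ n, |x n| < 1 := mem_DfRegular_iff.1 hz
  have hrec : ∀ n, x (n + 2) = 2 * Real.cos (angle N) * x (n + 1) - x n -
      2 * symb N ((Df N)^[n] z) := DfRegular.recurrence hN hz
  have h0 := hrec 0
  rw [Function.iterate_zero, id, h1] at h0
  set p := toTrapezoid N (-x 0 - 2, -x 1)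
  -- The negated orbit with the first overflow absorbed in the initial value. A second overflow
  -- would bring it below `-1` again: too early if within half a period, and otherwise `H N = x 0 +
  -- 2` exceeds `1`.
  set H : ℕ → ℝ := fun j => height N j p with hH
  have hH0 : H 0 = -x 0 - 2 := by simp [hH, p, height_zero_toTrapezoid]
  have hH1 : H 1 = -x 1 := by simp [hH, p, height_one_toTrapezoid hN]
  have hHr : ∀ j, H (j + 2) = 2 * Real.cos (angle N) * H (j + 1) - H j := fun j =>
    height_toTrapezoid_add_two j p
  have hHx : ∀ j, j ≤ m → H (j + 1) = -x (j + 1) ∧ H (j + 2) = -x (j + 2) := by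
    intro j hj
    induction j with
    | zero =>
      refine ⟨hH1, ?_⟩
      rw [hHr, zero_add, hH0, hH1, show (2 : ℕ) = 0 + 2 from rfl, h0]
      push_cast; ring
    | succ j ih =>
      obtain ⟨i1, i2⟩ := ih (by omega)
      refine ⟨i2, ?_⟩
      have h3 := hrec (j + 1)
      rw [hm j (by omega)] at h3
      rw [hHr, show j + 1 + 1 = j + 2 from rfl, i1, i2, h3]
      push_cast; ring
  have hlast : H (m + 3) = -x (m + 3) - 2 := by
    obtain ⟨i1, i2⟩ := hHx m le_rfl
    have h3 := hrec (m + 1)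
    rw [hcon] at h3
    rw [show m + 3 = m + 1 + 2 from rfl, hHr, show m + 1 + 1 = m + 2 from rfl, i1, i2, h3]
    push_cast; ring
  have b0 := abs_lt.1 (hx1 0)
  have b1 := abs_lt.1 (hx1 1)
  rcases le_or_gt (m + 3) N with h | h
  · have := neg_one_lt_of_crossing hN h (fun j _ => hHr j) (by linarith) (by linarith)
      (show 1 ≤ m + 3 by omega) le_rfl
    have b3 := abs_lt.1 (hx1 (m + 3))
    linarith
  · have h4 := sinusoid_half_period hN (fun j _ => hHr j)
    have h5 := (hHx (N - 2) (by omega)).2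
    rw [show N - 2 + 2 = N by omega] at h5
    have b3 := abs_lt.1 (hx1 N)
    linarith

theorem mode_cases (z : ℝ × ℝ) : mode N z = 0 ∨ mode N z = 1 := by
  unfold mode; split_ifs <;> simp

theorem underflowNext_of_symb_zero {z : ℝ × ℝ} (h : symb N z = 0) :
    UnderflowNext N z ↔ UnderflowNext N (Df N z) := by
  constructor
  · rintro ⟨m, hm, hi⟩
    cases m with
    | zero => rw [Function.iterate_zero, id, h] at hm; omega
    | succ m => exact ⟨m, hm, fun i hi' => hi (i + 1) (by omega)⟩
  · rintro ⟨m, hm, hi⟩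
    refine ⟨m + 1, hm, fun i hi' => ?_⟩
    cases i with
    | zero => exact h
    | succ i => exact hi i (by omega)

theorem not_underflowNext_of_symb_one {z : ℝ × ℝ} (h : symb N z = 1) : ¬ UnderflowNext N z := by
  rintro ⟨m, hm, hi⟩
  cases m with
  | zero => rw [Function.iterate_zero, id, h] at hm; omega
  | succ m =>
    have := hi 0 (by omega)
    rw [Function.iterate_zero, id, h] at this; omega

theorem Live.mode_Df (hN : 2 ≤ N) {z : ℝ × ℝ} (hz : Live N z) :
    mode N (Df N z) = mode N z + symb N z := by
  rcases symb_cases (N := N) z with h | h | h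
  · rw [h, add_zero]
    have := underflowNext_of_symb_zero h
    unfold mode
    split_ifs <;> tauto
  · have h1 : mode N z = 0 := if_neg (not_underflowNext_of_symb_one h)
    have h2 : UnderflowNext N (Df N z) := by
      classical
      have hex := hz.map.2.2
      refine ⟨Nat.find hex, ?_, fun i hi => not_not.1 (Nat.find_min hex hi)⟩
      have h3 := symb_ne_one_of_overflow hN hz.1 h (m := Nat.find hex)
        (fun i hi => not_not.1 (Nat.find_min hex hi))
      have h4 := Nat.find_spec hex
      rw [iterate_iterate_Df] at h4 ⊢
      have h5 := symb_cases (N := N) ((Df N)^[Nat.find hex + 1] z)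
      tauto
    rw [h1, h, mode, if_pos h2]; rfl
  · have h1 : mode N z = 1 := if_pos ⟨0, h, fun i hi => by omega⟩
    have h2 : ¬ UnderflowNext N (Df N z) := by
      rintro ⟨m, hm, hi⟩
      refine symb_ne_one_of_overflow hN (hz.neg hN).1 (m := m) ?_ (fun i hi' => ?_) ?_
      · have := DfRegular.symb_iterate_neg hN hz.1 0
        simp only [Function.iterate_zero, id, h] at this
        rw [this]; rfl
      · have := hi i hi'
        rw [iterate_iterate_Df] at this
        rw [DfRegular.symb_iterate_neg hN hz.1, this]; rfl
      · rw [iterate_iterate_Df] at hm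
        rw [DfRegular.symb_iterate_neg hN hz.1, hm]; rfl
    rw [h1, h, mode, if_neg h2]; rfl

theorem mode_of_mem {z w : ℝ × ℝ} (hw : w ∈ DfCell N z) : mode N w = mode N z := by
  have : UnderflowNext N w ↔ UnderflowNext N z := by
    unfold UnderflowNext; simp only [hw.2]
  unfold mode
  split_ifs <;> tauto

/-- At the first nonzero symbol both modes are forced, since adding opposite symbols must keep them
in `{0, 1}`. The zero symbols before it change neither mode. -/
theorem Live.mode_neg (hN : 2 ≤ N) {z : ℝ × ℝ} (hz : Live N z) :
    mode N (-z) = 1 - mode N z := by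
  have key : ∀ m (z : ℝ × ℝ), Live N z → (∀ i < m, symb N ((Df N)^[i] z) = 0) →
      symb N ((Df N)^[m] z) ≠ 0 → mode N (-z) = 1 - mode N z := by
    intro m
    induction m with
    | zero =>
      intro z hz _ h
      have h2 : symb N (-z) = -symb N z := DfRegular.symb_iterate_neg hN hz.1 0
      have h3 := hz.mode_Df hN
      have h4 := (hz.neg hN).mode_Df hN
      have c1 := mode_cases (N := N) z
      have c2 := mode_cases (N := N) (-z)
      have c3 := mode_cases (N := N) (Df N z)
      have c4 := mode_cases (N := N) (Df N (-z))
      rw [Function.iterate_zero, id] at h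
      omega
    | succ m ih =>
      intro z hz h0 h
      have h1 := h0 0 (by omega)
      have h2 : symb N (-z) = -symb N z := DfRegular.symb_iterate_neg hN hz.1 0
      rw [Function.iterate_zero, id] at h1
      have h3 := hz.mode_Df hN
      have h4 := (hz.neg hN).mode_Df hN
      have h5 := ih (Df N z) hz.map (fun i hi => h0 (i + 1) (by omega)) h
      have h6 : Df N (-z) = -Df N z := DfRegular.iterate_neg hN hz.1 1
      rw [← h6] at h5
      omega
  classical
  have hex := hz.2.2
  exact key (Nat.find hex) z hz (fun i hi => not_not.1 (Nat.find_min hex hi)) (Nat.find_spec hex)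

/-- A nonzero symbol changes the mode, so the mode is `1` on one side of that step. -/
theorem Live.exists_mode_one (hN : 2 ≤ N) {z : ℝ × ℝ} (hz : Live N z) :
    ∃ n, mode N ((Df N)^[n] z) = 1 := by
  obtain ⟨n, hn⟩ := hz.2.2
  have h1 := (hz.iterate n).mode_Df hN
  rw [← Function.iterate_succ_apply' (Df N)] at h1
  rcases mode_cases (N := N) ((Df N)^[n] z) with h | h
  · refine ⟨n + 1, ?_⟩
    have := mode_cases (N := N) ((Df N)^[n + 1] z)
    simp only [Nat.succ_eq_add_one] at h1
    omega
  · exact ⟨n, h⟩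

theorem Live.exists_mode_zero (hN : 2 ≤ N) {z : ℝ × ℝ} (hz : Live N z) :
    ∃ n, mode N ((Df N)^[n] z) = 0 := by
  obtain ⟨n, hn⟩ := (hz.neg hN).exists_mode_one hN
  refine ⟨n, ?_⟩
  rw [DfRegular.iterate_neg hN hz.1, (hz.iterate n).mode_neg hN] at hn
  omega

end mode

/-! ### Steps of the filter as steps of the Tangent map -/

section tangent

variable {N : ℕ}

theorem height_zero_tangentMap (b : ℤ) (w : ℝ × ℝ) :
    height N 0 (tangentMap N b w) = w.1 - 2 * b := height_zero_toTrapezoid _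

theorem height_one_tangentMap (hN : 2 ≤ N) (b : ℤ) (w : ℝ × ℝ) :
    height N 1 (tangentMap N b w) = w.2 := height_one_toTrapezoid hN _

theorem tangentMap_zero (w : ℝ × ℝ) : tangentMap N 0 w = toTrapezoid N w := by
  simp [tangentMap]

theorem tangentMap_eq (b : ℤ) (w : ℝ × ℝ) :
    tangentMap N b w = toTrapezoid N w - toTrapezoid N (2 * b, 0) := by
  rw [← toTrapezoid_sub]; simp [tangentMap, Prod.sub_def]

theorem tangentMap_heights (hN : 2 ≤ N) (b : ℤ) (p : ℂ) :
    tangentMap N b (height N 0 p + 2 * b, height N 1 p) = p := by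
  unfold tangentMap; rw [add_sub_cancel_right, toTrapezoid_heights hN]

/-- Vertex `0` has height `1` over both edge directions `0` and `1`, so subtracting an even multiple
of it corrects the shifted first coordinate and the overflow together. -/
theorem tangentMap_Df (hN : 2 ≤ N) {w : ℝ × ℝ} (hw : w ∈ DfRegular N) (b : ℤ) :
    tangentMap N (b + symb N w) (Df N w) =
      rot N (-1) * tangentMap N b w - 2 * ((b + symb N w : ℤ) : ℝ) * vertex N 0 := by
  have hr := DfRegular.recurrence hN hw 0
  rw [zero_add, show (2 : ℕ) = 1 + 1 from rfl, iterate_succ_fst, zero_add, iterate_succ_fst] at hr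
  simp only [Function.iterate_one, Function.iterate_zero, id] at hr
  have hm : ∀ u, height N u (2 * (((b + symb N w : ℤ) : ℝ) : ℂ) * vertex N 0) =
      2 * ((b + symb N w : ℤ) : ℝ) * height N u (vertex N 0) := by
    intro u; simp [height]; ring
  apply ext_height hN
  · rw [height_zero_tangentMap, height_sub, height_rot_mul, hm, height_vertex_zero hN, zero_sub,
      neg_neg, height_one_tangentMap hN, mul_one]
    rfl
  · rw [height_one_tangentMap hN, height_sub, height_rot_mul, hm, height_one_vertex_zero hN,
      show (1 : ℝ) - -1 = 0 + 2 by norm_num, height_add_two, zero_add, height_one_tangentMap hN,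
      height_zero_tangentMap, hr]
    push_cast; ring

theorem Live.tangentPt_Df (hN : 2 ≤ N) {z : ℝ × ℝ} (hz : Live N z) :
    tangentPt N (Df N z) = rot N (-1) * tangentPt N z - 2 * (mode N (Df N z) : ℝ) * vertex N 0 := by
  have := tangentMap_Df hN hz.1 (mode N z)
  rwa [← hz.mode_Df hN] at this

theorem Live.tangentPt_passive (hN : 2 ≤ N) {z : ℝ × ℝ} (hz : Live N z)
    (h : mode N (Df N z) = 0) : rot N (-1) * tangentPt N z = tangentPt N (Df N z) := by
  rw [hz.tangentPt_Df hN, h]; simp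

theorem Live.isContact_active (hN : 2 ≤ N) {z : ℝ × ℝ} (hz : Live N z)
    (h : mode N (Df N z) = 1) : IsContact N (rot N (-1) * tangentPt N z) (vertex N 0) := by
  have h1 := hz.tangentPt_Df hN
  rw [h] at h1
  have h2 : rot N (-1) * tangentPt N z = tangentPt N (Df N z) + 2 * vertex N 0 := by
    rw [h1]; push_cast; ring
  obtain ⟨h3, h4⟩ := mem_square.1 (hz.1 0)
  obtain ⟨h5, h6⟩ := mem_square.1 (hz.map.1 0)
  simp only [Function.iterate_zero, id] at h3 h4 h5 h6
  rw [abs_lt] at h4 h5 h6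
  rw [isContact_vertex_zero hN, h2, height_add, height_add, height_two_mul, height_two_mul,
    height_vertex_zero hN, height_one_vertex_zero hN]
  unfold tangentPt
  rw [height_zero_tangentMap, height_one_tangentMap hN, h]
  push_cast
  constructor <;> linarith

theorem Live.tau_active (hN : 2 ≤ N) {z : ℝ × ℝ} (hz : Live N z)
    (h : mode N (Df N z) = 1) :
    tau N (rot N (-1) * tangentPt N z) = rot N N * tangentPt N (Df N z) := by
  rw [tau_eq (hz.isContact_active hN h), hz.tangentPt_Df hN, h, rot_self hN]
  push_cast; ring

theorem rot_add_one_mul (j : ℤ) (p : ℂ) :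
    rot N j * p = rot N ((j + 1 : ℤ) : ℝ) * (rot N (-1) * p) := by
  rw [← mul_assoc, ← rot_add]; push_cast; ring_nf

theorem Live.rot_tangentPt_passive (hN : 2 ≤ N) {z : ℝ × ℝ} (hz : Live N z)
    (h : mode N (Df N z) = 0) (j : ℤ) :
    rot N j * tangentPt N z = rot N ((j + 1 : ℤ) : ℝ) * tangentPt N (Df N z) := by
  rw [rot_add_one_mul, hz.tangentPt_passive hN h]

theorem Live.isContact_rot_active (hN : 2 ≤ N) {z : ℝ × ℝ} (hz : Live N z)
    (h : mode N (Df N z) = 1) (j : ℤ) :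
    IsContact N (rot N j * tangentPt N z) (rot N ((j + 1 : ℤ) : ℝ) * vertex N 0) := by
  rw [rot_add_one_mul, isContact_rot_iff hN]
  exact hz.isContact_active hN h

theorem Live.tau_rot_active (hN : 2 ≤ N) {z : ℝ × ℝ} (hz : Live N z)
    (h : mode N (Df N z) = 1) (j : ℤ) :
    tau N (rot N j * tangentPt N z) =
      rot N ((j + 1 + N : ℤ) : ℝ) * tangentPt N (Df N z) := by
  rw [rot_add_one_mul, tau_rot hN, hz.tau_active hN h, ← mul_assoc, ← rot_add]
  push_cast; rfl

/-- A passive step only rewrites the same point with another rotation, and an active step reveals a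
contact vertex fixed by the rotation index. Modes agree on a region, so both points show the same
vertices. The inner inductions run over the steps before an active one. -/
theorem tangentPt_mem_tauCell (hN : 2 ≤ N) {z w : ℝ × ℝ} (hz : Live N z) (hw : w ∈ DfCell N z)
    (j : ℤ) : rot N j * tangentPt N w ∈ TauCell N (rot N j * tangentPt N z) := by
  intro t
  induction t generalizing z w j with
  | zero =>
    obtain ⟨n, hn⟩ := hz.map.exists_mode_one hN
    induction n generalizing z w j with
    | zero =>
      exact ⟨_, hz.isContact_rot_active hN hn j, (hz.of_mem hN hw).isContact_rot_active hN
        ((mode_of_mem (iterate_mem_DfCell hw 1)).trans hn) j⟩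
    | succ n ih =>
      rcases mode_cases (N := N) (Df N z) with h | h
      · have h' := (mode_of_mem (iterate_mem_DfCell hw 1)).trans h
        rw [hz.rot_tangentPt_passive hN h, (hz.of_mem hN hw).rot_tangentPt_passive hN h']
        exact ih hz.map (iterate_mem_DfCell hw 1) _ hn
      · exact ⟨_, hz.isContact_rot_active hN h j, (hz.of_mem hN hw).isContact_rot_active hN
          ((mode_of_mem (iterate_mem_DfCell hw 1)).trans h) j⟩
  | succ t iht =>
    obtain ⟨n, hn⟩ := hz.map.exists_mode_one hN
    have active : ∀ {z w : ℝ × ℝ}, Live N z → w ∈ DfCell N z → ∀ j : ℤ, mode N (Df N z) = 1 →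
        ∃ c, IsContact N ((tau N)^[t + 1] (rot N j * tangentPt N z)) c ∧
          IsContact N ((tau N)^[t + 1] (rot N j * tangentPt N w)) c := by
      intro z w hz hw j h
      have h' := (mode_of_mem (iterate_mem_DfCell hw 1)).trans h
      rw [Function.iterate_succ_apply, Function.iterate_succ_apply, hz.tau_rot_active hN h,
        (hz.of_mem hN hw).tau_rot_active hN h']
      exact iht hz.map (iterate_mem_DfCell hw 1) _
    induction n generalizing z w j with
    | zero => exact active hz hw j hn
    | succ n ih =>
      rcases mode_cases (N := N) (Df N z) with h | h
      · have h' := (mode_of_mem (iterate_mem_DfCell hw 1)).trans h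
        rw [hz.rot_tangentPt_passive hN h, (hz.of_mem hN hw).rot_tangentPt_passive hN h']
        exact ih hz.map (iterate_mem_DfCell hw 1) _ hn
      · exact active hz hw j h

theorem Live.tangentPt_mem_tauRegular (hN : 2 ≤ N) {z : ℝ × ℝ} (hz : Live N z) (j : ℤ) :
    rot N j * tangentPt N z ∈ TauRegular N := by
  intro t
  obtain ⟨c, hc, -⟩ := tangentPt_mem_tauCell hN hz (mem_DfCell_self hz.1) j t
  exact ⟨c, hc⟩

/-- The displacement of a point with the same corner sequence is rotated along the orbit. -/
theorem add_rot_mem_tauCell (hN : 2 ≤ N) {z : ℝ × ℝ} (hz : Live N z) {d : ℂ}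
    (hd : tangentPt N z + d ∈ TauCell N (tangentPt N z)) :
    tangentPt N (Df N z) + rot N (-1) * d ∈ TauCell N (tangentPt N (Df N z)) := by
  have h1 := mem_tauCell_rot hN (-1) hd
  rw [Int.cast_neg, Int.cast_one] at h1
  rcases mode_cases (N := N) (Df N z) with h | h
  · rw [← hz.tangentPt_passive hN h, ← mul_add]
    exact h1
  · obtain ⟨c, h2, h3⟩ := h1 0
    obtain rfl := h2.unique (hz.isContact_active hN h)
    rw [Function.iterate_zero, id] at h3
    -- The half turn undoes the sign that `τ` puts on both the point and the displacement.
    have h4 := mem_tauCell_rot hN N (tau_mem_tauCell h1)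
    rw [hz.tau_active hN h, tau_eq h3, Int.cast_natCast, rot_self hN] at h4
    have h5 := hz.tangentPt_Df hN
    rw [h] at h5
    convert h4 using 1
    · congr 1; ring
    · rw [h5]; push_cast; ring

/-- For the harder inclusion, the displacement of a point of the tile rotates along the orbit, and
equal contacts at active steps supply the inequalities that `abs_lt_one_of_contacts` needs to bound
the whole displaced sequence. -/
theorem tauCell_tangentPt (hN : 2 ≤ N) {z : ℝ × ℝ} (hz : Live N z) :
    TauCell N (tangentPt N z) = tangentMap N (mode N z) '' DfCell N z := by
  apply Set.Subset.antisymm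
  · intro p hp
    set b := mode N z with hb
    set d := p - tangentPt N z with hd
    refine ⟨(height N 0 p + 2 * b, height N 1 p), ?_, tangentMap_heights hN b p⟩
    rw [mem_DfCell_iff hN hz.1]
    have hdw : toTrapezoid N (height N 0 p + 2 * b, height N 1 p) - toTrapezoid N z = d := by
      have h1 := tangentMap_eq (N := N) b (height N 0 p + 2 * b, height N 1 p)
      have h2 := tangentMap_eq (N := N) b z
      rw [tangentMap_heights hN] at h1
      rw [hd, tangentPt, ← hb, h2]
      linear_combination -h1
    rw [hdw]
    have hcell : ∀ n : ℕ, tangentPt N ((Df N)^[n] z) + rot N (-n) * d ∈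
        TauCell N (tangentPt N ((Df N)^[n] z)) := by
      intro n
      induction n with
      | zero =>
        simp only [Function.iterate_zero, id, Nat.cast_zero, neg_zero, rot_zero, one_mul, hd,
          add_sub_cancel]
        exact hp
      | succ n ih =>
        have := add_rot_mem_tauCell hN (hz.iterate n) ih
        rw [← mul_assoc, ← rot_add] at this
        rw [Function.iterate_succ_apply']
        convert this using 4
        push_cast; ring
    obtain ⟨l, hl0, hl⟩ := hz.2.1
    have hq : 0 < l * (2 * N) := Nat.mul_pos hl0 (by omega)
    refine abs_lt_one_of_contacts hN (x := fun n => ((Df N)^[n] z).1)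
      (X := fun n => ((Df N)^[n] z).1 + height N n d) (s := fun n => symb N ((Df N)^[n] z))
      (b := fun n => mode N ((Df N)^[n] z)) (DfRegular.recurrence hN hz.1) ?_ ?_
      (fun n => mode_cases _) (mem_DfRegular_iff.1 hz.1) hq ?_ ?_ ?_
    · intro n
      rw [DfRegular.recurrence hN hz.1, height_toTrapezoid_add_two]; ring
    · intro n
      rw [Function.iterate_succ_apply', (hz.iterate n).mode_Df hN]
    · intro n
      rw [Function.iterate_add_apply, (hl.mul_const (2 * N)).eq]
      have h1 := height_rot_mul (N := N) (n + l * (2 * N) : ℝ) (((l : ℤ) : ℝ) * (2 * N)) d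
      rw [rot_int_mul hN, one_mul] at h1
      push_cast at h1 ⊢
      rw [h1, add_sub_cancel_right]
    · intro n
      obtain ⟨i, hi⟩ := (hz.iterate n).exists_mode_one hN
      refine ⟨i, ?_⟩
      rw [add_comm n i, Function.iterate_add_apply]; exact hi
    · intro n hn
      rw [Function.iterate_succ_apply'] at hn
      have h1 := mem_tauCell_rot hN (-1) (hcell n)
      rw [Int.cast_neg, Int.cast_one] at h1
      obtain ⟨c, h2, h3⟩ := h1 0
      obtain rfl := h2.unique ((hz.iterate n).isContact_active hN hn)
      rw [Function.iterate_zero, id, isContact_vertex_zero hN, mul_add, ← mul_assoc, ← rot_add,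
        height_add, height_add, height_rot_mul, height_rot_mul 0, height_rot_mul 1,
        height_rot_mul 1] at h3
      have h4 := (hz.iterate n).tangentPt_Df hN
      rw [hn] at h4
      have h5 : rot N (-1) * tangentPt N ((Df N)^[n] z) =
          tangentPt N (Df N ((Df N)^[n] z)) + 2 * vertex N 0 := by
        rw [h4]; push_cast; ring
      have h6 := congrArg (height N 1) h5
      rw [height_rot_mul, height_add, height_two_mul, height_one_vertex_zero hN, tangentPt,
        tangentPt, height_one_tangentMap hN, ← Function.iterate_succ_apply' (Df N)] at h6
      rw [tangentPt, zero_sub, neg_neg, height_one_tangentMap hN, h6] at h3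
      rw [show n + 2 = n + 1 + 1 from rfl, iterate_succ_fst, iterate_succ_fst]
      push_cast
      have e1 : (0 : ℝ) - (-1 + -(n : ℝ)) = n + 1 := by ring
      have e2 : (1 : ℝ) - (-1 + -(n : ℝ)) = n + 1 + 1 := by ring
      rw [e1, e2] at h3
      exact ⟨h3.1, by linarith [h3.2]⟩
  · rintro _ ⟨w, hw, rfl⟩
    have := tangentPt_mem_tauCell hN hz hw 0
    rw [Int.cast_zero, rot_zero, one_mul, one_mul] at this
    have h : tangentPt N w = tangentMap N (mode N z) w := by rw [tangentPt, mode_of_mem hw]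
    rwa [h] at this

theorem tauCell_rot_tangentPt (hN : 2 ≤ N) {z : ℝ × ℝ} (hz : Live N z) (j : ℤ) :
    TauCell N (rot N j * tangentPt N z) =
      (fun w => rot N j * tangentMap N (mode N z) w) '' DfCell N z := by
  have : TauCell N (rot N j * tangentPt N z) = (fun p => rot N j * p) '' TauCell N (tangentPt N z) := by
    apply Set.Subset.antisymm
    · intro p hp
      refine ⟨rot N (-j) * p, ?_, ?_⟩
      · rw [← mem_tauCell_rot_iff hN j, ← mul_assoc, rot_mul_rot_neg, one_mul]; exact hp
      · change rot N j * (rot N (-j) * p) = p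
        rw [← mul_assoc, rot_mul_rot_neg, one_mul]
    · rintro _ ⟨p, hp, rfl⟩
      exact mem_tauCell_rot hN j hp
  rw [this, tauCell_tangentPt hN hz, Set.image_image]

/-- Here `t` counts the active steps and `j` collects the rotations. The last clause ensures that a
return of `Df` gives a nontrivial return of `τ`. -/
theorem Live.exists_tau_iterate (hN : 2 ≤ N) {z : ℝ × ℝ} (hz : Live N z) (n : ℕ) :
    ∃ (t : ℕ) (j : ℤ), (tau N)^[t] (tangentPt N z) = rot N j * tangentPt N ((Df N)^[n] z) ∧
      ((∃ i < n, mode N ((Df N)^[i + 1] z) = 1) → 0 < t) := by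
  induction n with
  | zero => exact ⟨0, 0, by simp [rot_zero], by simp⟩
  | succ n ih =>
    obtain ⟨t, j, h1, h2⟩ := ih
    rw [Function.iterate_succ_apply']
    rcases mode_cases (N := N) (Df N ((Df N)^[n] z)) with h | h
    · refine ⟨t, j + 1, ?_, ?_⟩
      · rw [h1, (hz.iterate n).rot_tangentPt_passive hN h]
      · rintro ⟨i, hi, hi'⟩
        refine h2 ⟨i, ?_, hi'⟩
        rcases Nat.lt_succ_iff_lt_or_eq.1 hi with h3 | rfl
        · exact h3
        · rw [Function.iterate_succ_apply', h] at hi'; omega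
    · refine ⟨t + 1, j + 1 + N, ?_, fun _ => Nat.succ_pos t⟩
      rw [Function.iterate_succ_apply', h1, (hz.iterate n).tau_rot_active hN h]

theorem Live.tangentPt_mem_periodicPts (hN : 2 ≤ N) {z : ℝ × ℝ} (hz : Live N z) (j : ℤ) :
    rot N j * tangentPt N z ∈ Function.periodicPts (tau N) := by
  obtain ⟨l, hl0, hl⟩ := hz.2.1
  obtain ⟨i, hi⟩ := hz.map.exists_mode_one hN
  -- A multiple of the period that exceeds `i`, so that the active step is included. The return is
  -- only up to a rotation, which `2N` repetitions remove.
  obtain ⟨t, m, h1, h2⟩ := hz.exists_tau_iterate hN (l * (i + 1))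
  rw [(hl.mul_const (i + 1)).eq] at h1
  have ht : 0 < t := h2 ⟨i, by nlinarith, hi⟩
  have hk : ∀ k : ℕ, (tau N)^[t * k] (tangentPt N z) = rot N ((k * m : ℤ) : ℝ) * tangentPt N z := by
    intro k
    induction k with
    | zero => simp [rot_zero]
    | succ k ih =>
      rw [Nat.mul_succ, add_comm, Function.iterate_add_apply, ih, tau_iterate_rot hN, h1,
        ← mul_assoc, ← rot_add]
      push_cast; ring_nf
  refine ⟨t * (2 * N), Nat.mul_pos ht (by omega), ?_⟩
  change (tau N)^[_] _ = _
  rw [tau_iterate_rot hN, hk, show (((2 * N : ℕ) * m : ℤ) : ℝ) = m * (2 * N) by push_cast; ring,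
    rot_int_mul hN, one_mul]

/-- A point of Tangent space determines the active point it comes from. -/
theorem rot_tangentPt_injective (hN : 2 ≤ N) {z w : ℝ × ℝ} (hz : Live N z) (hw : Live N w)
    (hz1 : mode N (Df N z) = 1) (hw1 : mode N (Df N w) = 1) {i j : ℕ} (hi : i < 2 * N)
    (hj : j < 2 * N) (h : rot N i * tangentPt N z = rot N j * tangentPt N w) :
    i = j ∧ z = w := by
  have h1 := hz.isContact_rot_active hN hz1 i
  have h2 := hw.isContact_rot_active hN hw1 j
  rw [Int.cast_natCast] at h1 h2
  rw [h] at h1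
  have h3 := h1.unique h2
  have hv : vertex N 0 ≠ 0 := by
    intro h4
    have := height_vertex_zero hN
    rw [h4] at this
    simp [height] at this
  have h4 := mul_right_cancel₀ hv h3
  push_cast at h4
  rw [rot_add, rot_add] at h4
  have h5 := rot_nat_injOn hN hi hj (mul_right_cancel₀ (rot_ne_zero _) h4)
  subst h5
  refine ⟨rfl, ?_⟩
  have h6 := mul_left_cancel₀ (rot_ne_zero _) h
  have h7 := congrArg (height N 0) h6
  have h8 := congrArg (height N 1) h6
  unfold tangentPt at h7 h8
  rw [height_zero_tangentMap, height_zero_tangentMap] at h7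
  rw [height_one_tangentMap hN, height_one_tangentMap hN] at h8
  have b1 := abs_lt.1 (mem_square.1 (hz.1 0)).1
  have b2 := abs_lt.1 (mem_square.1 (hw.1 0)).1
  simp only [Function.iterate_zero, id] at b1 b2
  refine Prod.ext ?_ h8
  -- Different modes would put the first coordinates at distance `2`, impossible in the open square.
  rcases mode_cases (N := N) z with c | c <;> rcases mode_cases (N := N) w with c' | c' <;>
    rw [c, c'] at h7 <;> push_cast at h7 <;> linarith

end tangent

/-! ### Finite orbits and their representatives -/

section orbits

variable {α : Type*} {f : α → α}

/-- The forward orbit of a point. -/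
def forwardOrbit (f : α → α) (x : α) : Set α := {y | ∃ n : ℕ, f^[n] x = y}

theorem forwardOrbit_eq_of_mem {x y : α} (hx : x ∈ Function.periodicPts f)
    (hy : y ∈ forwardOrbit f x) : forwardOrbit f y = forwardOrbit f x := by
  obtain ⟨n, rfl⟩ := hy
  obtain ⟨m, hm⟩ := exists_iterate_iterate_eq hx n
  apply Set.Subset.antisymm
  · rintro _ ⟨i, rfl⟩
    exact ⟨i + n, Function.iterate_add_apply _ _ _ _⟩
  · rintro _ ⟨i, rfl⟩
    refine ⟨i + m, ?_⟩
    rw [Function.iterate_add_apply, hm]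

theorem forwardOrbit_eq_image {x : α} (hx : x ∈ Function.periodicPts f) :
    forwardOrbit f x =
      (fun n => f^[n] x) '' (Finset.range (Function.minimalPeriod f x) : Set ℕ) := by
  apply Set.Subset.antisymm
  · rintro _ ⟨n, rfl⟩
    refine ⟨n % Function.minimalPeriod f x, ?_, Function.iterate_mod_minimalPeriod_eq⟩
    rw [Finset.mem_coe, Finset.mem_range]
    exact Nat.mod_lt _ (Function.minimalPeriod_pos_of_mem_periodicPts hx)
  · rintro _ ⟨n, -, rfl⟩
    exact ⟨n, rfl⟩

theorem finite_forwardOrbit {x : α} (hx : x ∈ Function.periodicPts f) :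
    (forwardOrbit f x).Finite := by
  rw [forwardOrbit_eq_image hx]; exact (Finset.finite_toSet _).image _

theorem ncard_forwardOrbit {x : α} (hx : x ∈ Function.periodicPts f) :
    (forwardOrbit f x).ncard = Function.minimalPeriod f x := by
  rw [forwardOrbit_eq_image hx, Set.InjOn.ncard_image, Set.ncard_coe_finset, Finset.card_range]
  rw [Finset.coe_range]
  exact Function.iterate_injOn_Iio_minimalPeriod

/-- Representatives of the orbits of a map on a finite set of periodic points. -/
theorem exists_orbit_representatives [Nonempty α] {X : Set α} (hX : X.Finite)
    (hf : Set.MapsTo f X X) (hp : ∀ x ∈ X, x ∈ Function.periodicPts f) :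
    ∃ R : Finset α, (∀ r ∈ R, r ∈ X) ∧ (∀ p ∈ X, ∃! r, r ∈ R ∧ ∃ n : ℕ, f^[n] r = p) ∧
      ∑ r ∈ R, Function.minimalPeriod f r = X.ncard := by
  classical
  -- The choice depends only on the orbit as a set, so points of one orbit share a representative.
  set rep : α → α := fun x => Classical.epsilon (fun y => y ∈ forwardOrbit f x) with hrep
  have hmem : ∀ x, rep x ∈ forwardOrbit f x := fun x =>
    Classical.epsilon_spec (p := fun y => y ∈ forwardOrbit f x) ⟨x, 0, rfl⟩
  have hrepeq : ∀ {x y}, forwardOrbit f x = forwardOrbit f y → rep x = rep y := by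
    intro x y h; simp only [hrep, h]
  have hsub : ∀ x ∈ X, forwardOrbit f x ⊆ X := by
    rintro x hx _ ⟨n, rfl⟩
    exact hf.iterate n hx
  have hrepX : ∀ x ∈ X, rep x ∈ X := fun x hx => hsub x hx (hmem x)
  have horb : ∀ x ∈ X, forwardOrbit f (rep x) = forwardOrbit f x := fun x hx =>
    forwardOrbit_eq_of_mem (hp x hx) (hmem x)
  refine ⟨hX.toFinset.image rep, ?_, ?_, ?_⟩
  · intro r hr
    obtain ⟨x, hx, rfl⟩ := Finset.mem_image.1 hr
    exact hrepX x (hX.mem_toFinset.1 hx)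
  · intro p hpX
    refine ⟨rep p, ⟨Finset.mem_image_of_mem _ (hX.mem_toFinset.2 hpX), ?_⟩, ?_⟩
    · have h : p ∈ forwardOrbit f (rep p) := by rw [horb p hpX]; exact ⟨0, rfl⟩
      exact h
    · rintro r ⟨hr, hn⟩
      obtain ⟨x, hx, rfl⟩ := Finset.mem_image.1 hr
      have hx' := hX.mem_toFinset.1 hx
      have h1 := forwardOrbit_eq_of_mem (hp _ (hrepX x hx')) hn
      exact hrepeq ((horb x hx').symm.trans h1.symm)
  -- The fibers of `rep` on `X` are the orbits, whose sizes are the least periods.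
  · rw [Set.ncard_eq_toFinset_card X hX, Finset.card_eq_sum_card_image rep]
    refine Finset.sum_congr rfl fun r hr => ?_
    obtain ⟨x, hx, rfl⟩ := Finset.mem_image.1 hr
    have hx' := hX.mem_toFinset.1 hx
    rw [← ncard_forwardOrbit (hp _ (hrepX x hx')), ← Set.ncard_coe_finset]
    congr 1
    ext a
    rw [Finset.mem_coe, Finset.mem_filter, hX.mem_toFinset, horb x hx']
    constructor
    · intro ha
      exact ⟨hsub x hx' ha, hrepeq (forwardOrbit_eq_of_mem (hp x hx') ha)⟩
    · rintro ⟨ha, har⟩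
      rw [← horb x hx', ← har, horb a ha]
      exact ⟨0, rfl⟩

end orbits

/-! ### Congruence of the tiles -/

section congruence

variable {N : ℕ}

theorem AreCongruent.trans {A B C : Set ℂ} (h1 : AreCongruent A B) (h2 : AreCongruent B C) :
    AreCongruent A C := by
  obtain ⟨e, rfl⟩ := h1
  obtain ⟨e', rfl⟩ := h2
  exact ⟨e.trans e', by rw [Set.image_image]; rfl⟩

theorem areCongruent_image (u : ℝ) (v : ℂ) (A : Set ℂ) :
    AreCongruent A ((fun p => rot N u * p + v) '' A) :=
  ⟨{ toFun := fun p => rot N u * p + v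
     invFun := fun p => rot N (-u) * (p - v)
     left_inv := fun p => by
      change rot N (-u) * (rot N u * p + v - v) = p
      rw [add_sub_cancel_right, ← mul_assoc, rot_neg_mul_rot, one_mul]
     right_inv := fun p => by
      change rot N u * (rot N (-u) * (p - v)) + v = p
      rw [← mul_assoc, rot_mul_rot_neg, one_mul, sub_add_cancel]
     isometry_toFun := Isometry.of_dist_eq fun p q => by
      rw [dist_add_right, dist_eq_norm, ← mul_sub, norm_mul, norm_rot, one_mul, dist_eq_norm] },
    rfl⟩

theorem areCongruent_iterate (hN : 2 ≤ N) {z : ℝ × ℝ} (hz : z ∈ DfRegular N)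
    (hp : z ∈ Function.periodicPts (Df N)) (n : ℕ) :
    AreCongruent (toTrapezoid N '' DfCell N z) (toTrapezoid N '' DfCell N ((Df N)^[n] z)) := by
  rw [← image_iterate_DfCell hN hz hp, Set.image_image]
  have := areCongruent_image (N := N) (-n)
    (toTrapezoid N ((Df N)^[n] z) - rot N (-n) * toTrapezoid N z) (toTrapezoid N '' DfCell N z)
  rw [Set.image_image] at this
  convert this using 1
  refine Set.image_congr fun w hw => ?_
  rw [toTrapezoid_iterate hN hz hw]; ring

theorem areCongruent_neg (hN : 2 ≤ N) {z : ℝ × ℝ} (hz : z ∈ DfRegular N) :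
    AreCongruent (toTrapezoid N '' DfCell N z) (toTrapezoid N '' DfCell N (-z)) := by
  rw [← image_neg_DfCell hN hz, Set.image_image]
  have := areCongruent_image (N := N) N 0 (toTrapezoid N '' DfCell N z)
  rw [Set.image_image] at this
  convert this using 1
  refine Set.image_congr fun w hw => ?_
  rw [toTrapezoid_neg, rot_self hN]; ring

theorem areCongruent_tauCell (hN : 2 ≤ N) {z : ℝ × ℝ} (hz : Live N z) (j : ℤ) :
    AreCongruent (toTrapezoid N '' DfCell N z) (TauCell N (rot N j * tangentPt N z)) := by
  rw [tauCell_rot_tangentPt hN hz]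
  have := areCongruent_image (N := N) j (-(rot N j * toTrapezoid N (2 * mode N z, 0)))
    (toTrapezoid N '' DfCell N z)
  rw [Set.image_image] at this
  convert this using 1
  refine Set.image_congr fun w hw => ?_
  rw [tangentMap_eq]; ring

end congruence

/-! ### Listing and counting the tiles -/

section tiles

variable {N : ℕ}

theorem center_tauCell (hN : 2 ≤ N) {z : ℝ × ℝ} (hz : Live N z) (hc : center (DfCell N z) = z)
    (j : ℤ) : center (TauCell N (rot N j * tangentPt N z)) = rot N j * tangentPt N z := by
  have h := center_image_affine (trapezoidEquiv hN j)
    (-(rot N j * toTrapezoid N (2 * mode N z, 0))) (isOpen_DfCell hN hz.1 hz.2.1)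
    ⟨z, mem_DfCell_self hz.1⟩ (isBounded_DfCell z)
  have e : ∀ w, trapezoidEquiv hN j w + -(rot N j * toTrapezoid N (2 * mode N z, 0)) =
      rot N j * tangentMap N (mode N z) w := by
    intro w; rw [tangentMap_eq, trapezoidEquiv_apply]; ring
  simp only [e] at h
  rw [tauCell_rot_tangentPt hN hz, h, hc]; rfl

theorem image_tau_tauCell (hN : 2 ≤ N) {z : ℝ × ℝ} (hz : Live N z) (h : mode N (Df N z) = 1)
    (j : ℤ) : tau N '' TauCell N (rot N j * tangentPt N z) =
      TauCell N (rot N ((j + 1 + N : ℤ) : ℝ) * tangentPt N (Df N z)) := by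
  rw [tauCell_rot_tangentPt hN hz, tauCell_rot_tangentPt hN hz.map, Set.image_image,
    show DfCell N (Df N z) = DfCell N ((Df N)^[1] z) from rfl,
    ← image_iterate_DfCell hN hz.1 hz.2.1, Set.image_image]
  refine Set.image_congr fun w hw => ?_
  have hw1 := iterate_mem_DfCell hw 1
  have := (hz.of_mem hN hw).tau_rot_active hN ((mode_of_mem hw1).trans h) j
  rw [tangentPt, tangentPt, mode_of_mem hw] at this
  have h2 : mode N (Df N w) = mode N (Df N z) := mode_of_mem hw1
  rw [this, h2]; rfl

theorem image_rot_toTrapezoid_neg (hN : 2 ≤ N) {z : ℝ × ℝ} (hz : z ∈ DfRegular N) (j : ℤ) :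
    (fun w => rot N j * w) '' (toTrapezoid N '' DfCell N (-z)) =
      (fun w => rot N ((j + N : ℤ) : ℝ) * w) '' (toTrapezoid N '' DfCell N z) := by
  rw [← image_neg_DfCell hN hz]
  simp only [Set.image_image]
  refine Set.image_congr fun w _ => ?_
  rw [toTrapezoid_neg, Int.cast_add, rot_add, Int.cast_natCast, rot_self hN]; ring

theorem tauCell_eq_of_mode_zero (hN : 2 ≤ N) {z : ℝ × ℝ} (hz : Live N z) (h : mode N z = 0)
    (j : ℤ) : TauCell N (rot N j * tangentPt N z) =
      (fun w => rot N j * w) '' (toTrapezoid N '' DfCell N z) := by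
  rw [tauCell_rot_tangentPt hN hz, h, Set.image_image]
  simp only [tangentMap_zero]

/-- The orbit of `c` together with the complementary orbit. -/
def symmetricOrbit (N : ℕ) (c : ℝ × ℝ) : Set (ℝ × ℝ) :=
  forwardOrbit (Df N) c ∪ {w | -w ∈ forwardOrbit (Df N) c}

variable {c : ℝ × ℝ}

theorem Live.of_mem_symmetricOrbit (hN : 2 ≤ N) (hc : Live N c) {w : ℝ × ℝ}
    (hw : w ∈ symmetricOrbit N c) : Live N w := by
  rcases hw with ⟨n, rfl⟩ | ⟨n, hn⟩
  · exact hc.iterate n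
  · rw [← neg_neg w, ← hn]; exact (hc.iterate n).neg hN

theorem neg_mem_symmetricOrbit {w : ℝ × ℝ} (hw : w ∈ symmetricOrbit N c) :
    -w ∈ symmetricOrbit N c := by
  rcases hw with h | h
  · exact .inr (by rwa [Set.mem_ofPred_eq, neg_neg])
  · exact .inl h

theorem iterate_mem_symmetricOrbit (hN : 2 ≤ N) (hc : Live N c) {w : ℝ × ℝ}
    (hw : w ∈ symmetricOrbit N c) (m : ℕ) : (Df N)^[m] w ∈ symmetricOrbit N c := by
  have hl := hc.of_mem_symmetricOrbit hN hw
  rcases hw with ⟨n, rfl⟩ | ⟨n, hn⟩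
  · exact .inl ⟨m + n, Function.iterate_add_apply _ _ _ _⟩
  · refine .inr ⟨m + n, ?_⟩
    rw [Function.iterate_add_apply, hn, DfRegular.iterate_neg hN hl.1]

theorem map_mem_symmetricOrbit (hN : 2 ≤ N) (hc : Live N c) {w : ℝ × ℝ}
    (hw : w ∈ symmetricOrbit N c) : Df N w ∈ symmetricOrbit N c :=
  iterate_mem_symmetricOrbit hN hc hw 1

theorem center_of_mem_symmetricOrbit (hN : 2 ≤ N) (hc : Live N c)
    (hcc : center (DfCell N c) = c) {w : ℝ × ℝ} (hw : w ∈ symmetricOrbit N c) :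
    center (DfCell N w) = w := by
  rcases hw with ⟨n, rfl⟩ | ⟨n, hn⟩
  · rw [center_image_DfCell hN hc.1 hc.2.1, hcc]
  · have h := hc.iterate n
    rw [← neg_neg w, ← hn, center_DfCell_neg hN h.1 h.2.1, center_image_DfCell hN hc.1 hc.2.1, hcc]

theorem areCongruent_of_mem_symmetricOrbit (hN : 2 ≤ N) (hc : Live N c) {w : ℝ × ℝ}
    (hw : w ∈ symmetricOrbit N c) :
    AreCongruent (toTrapezoid N '' DfCell N c) (toTrapezoid N '' DfCell N w) := by
  rcases hw with ⟨n, rfl⟩ | ⟨n, hn⟩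
  · exact areCongruent_iterate hN hc.1 hc.2.1 n
  · rw [← neg_neg w, ← hn]
    exact (areCongruent_iterate hN hc.1 hc.2.1 n).trans (areCongruent_neg hN (hc.iterate n).1)

theorem trapezoidTiles_eq (hN : 2 ≤ N) (hc : Live N c) :
    trapezoidTiles N (DfCell N c) =
      (fun w => toTrapezoid N '' DfCell N w) '' symmetricOrbit N c := by
  ext V
  constructor
  · rintro ⟨i, rfl | rfl⟩
    · exact ⟨_, .inl ⟨i, rfl⟩, by rw [image_iterate_DfCell hN hc.1 hc.2.1]⟩
    · refine ⟨_, .inr ⟨i, (neg_neg _).symm⟩, ?_⟩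
      rw [image_iterate_DfCell hN hc.1 hc.2.1, image_neg_DfCell hN (hc.iterate i).1]
  · rintro ⟨w, ⟨n, rfl⟩ | ⟨n, hn⟩, rfl⟩
    · exact ⟨n, .inl (by rw [image_iterate_DfCell hN hc.1 hc.2.1])⟩
    · refine ⟨n, .inr ?_⟩
      rw [image_iterate_DfCell hN hc.1 hc.2.1, image_neg_DfCell hN (hc.iterate n).1, hn, neg_neg]

theorem DfCell_injOn (hN : 2 ≤ N) (hc : Live N c) (hcc : center (DfCell N c) = c) :
    Set.InjOn (fun w => toTrapezoid N '' DfCell N w) (symmetricOrbit N c) := by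
  intro v hv w hw h
  have h1 := (toTrapezoid_injective hN).image_injective h
  rw [← center_of_mem_symmetricOrbit hN hc hcc hv, h1, center_of_mem_symmetricOrbit hN hc hcc hw]

theorem pairwiseDisjoint_trapezoidTiles (hN : 2 ≤ N) (hc : Live N c) :
    (trapezoidTiles N (DfCell N c)).PairwiseDisjoint id := by
  rw [trapezoidTiles_eq hN hc]
  rintro _ ⟨v, hv, rfl⟩ _ ⟨w, hw, rfl⟩ hne
  rw [Function.onFun, id, id, Set.disjoint_image_iff (toTrapezoid_injective hN)]
  rw [Set.disjoint_left]
  intro p hp hp'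
  refine hne ?_
  simp only
  rw [← DfCell_eq_of_mem hp, ← DfCell_eq_of_mem hp']

/-- Points of the symmetric orbit for which the next step of `Df` is a step of `τ`. -/
def activeOrbit (N : ℕ) (c : ℝ × ℝ) : Set (ℝ × ℝ) :=
  {w | w ∈ symmetricOrbit N c ∧ mode N (Df N w) = 1}

theorem finite_symmetricOrbit (hc : c ∈ Function.periodicPts (Df N)) :
    (symmetricOrbit N c).Finite :=
  (finite_forwardOrbit hc).union ((finite_forwardOrbit hc).preimage neg_injective.injOn)

/-- Negation commutes with `Df` on these points and exchanges the modes, so it swaps active and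
inactive points. -/
theorem symmetricOrbit_eq_union (hN : 2 ≤ N) (hc : Live N c) :
    symmetricOrbit N c = activeOrbit N c ∪ (fun w => -w) '' activeOrbit N c ∧
      Disjoint (activeOrbit N c) ((fun w => -w) '' activeOrbit N c) := by
  have hm : ∀ w ∈ symmetricOrbit N c, mode N (Df N (-w)) = 1 - mode N (Df N w) := by
    intro w hw
    have hl := hc.of_mem_symmetricOrbit hN hw
    have : Df N (-w) = -Df N w := DfRegular.iterate_neg hN hl.1 1
    rw [this, hl.map.mode_neg hN]
  constructor
  · ext w
    constructor
    · intro hw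
      rcases mode_cases (N := N) (Df N w) with h | h
      · refine .inr ⟨-w, ⟨neg_mem_symmetricOrbit hw, ?_⟩, neg_neg w⟩
        rw [hm w hw, h]; rfl
      · exact .inl ⟨hw, h⟩
    · rintro (h | ⟨v, hv, rfl⟩)
      · exact h.1
      · exact neg_mem_symmetricOrbit hv.1
  · rw [Set.disjoint_left]
    rintro _ h ⟨v, hv, rfl⟩
    have h1 := h.2
    rw [hm v hv.1, hv.2] at h1
    omega

theorem ncard_symmetricOrbit (hN : 2 ≤ N) (hc : Live N c) :
    (symmetricOrbit N c).ncard = 2 * (activeOrbit N c).ncard := by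
  obtain ⟨h1, h2⟩ := symmetricOrbit_eq_union hN hc
  have hfin : (activeOrbit N c).Finite :=
    (finite_symmetricOrbit hc.2.1).subset fun w hw => hw.1
  rw [h1, Set.ncard_union_eq h2 hfin (hfin.image _), Set.ncard_image_of_injective _ neg_injective]
  ring

theorem ncard_symmetricOrbit_of_eq (hc : c ∈ Function.periodicPts (Df N))
    (h : {w | -w ∈ forwardOrbit (Df N) c} = forwardOrbit (Df N) c) :
    (symmetricOrbit N c).ncard = Function.minimalPeriod (Df N) c := by
  rw [symmetricOrbit, h, Set.union_self, ncard_forwardOrbit hc]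

theorem ncard_symmetricOrbit_of_ne (hN : 2 ≤ N) (hc : Live N c)
    (h : {w | -w ∈ forwardOrbit (Df N) c} ≠ forwardOrbit (Df N) c) :
    (symmetricOrbit N c).ncard = 2 * Function.minimalPeriod (Df N) c := by
  have himg : {w | -w ∈ forwardOrbit (Df N) c} = (fun w => -w) '' forwardOrbit (Df N) c := by
    ext w
    exact ⟨fun hw => ⟨-w, hw, neg_neg w⟩, by rintro ⟨v, hv, rfl⟩; simpa using hv⟩
  have hneg : {w | -w ∈ forwardOrbit (Df N) c} = forwardOrbit (Df N) (-c) := by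
    ext w
    refine exists_congr fun n => ?_
    rw [DfRegular.iterate_neg hN hc.1, neg_eq_iff_eq_neg]
  -- The complementary set is the orbit of `-c`, and two periodic orbits with a common point
  -- coincide.
  have hdisj : Disjoint (forwardOrbit (Df N) c) {w | -w ∈ forwardOrbit (Df N) c} := by
    rw [Set.disjoint_left]
    intro w hw hw'
    rw [hneg] at hw' h
    exact h ((forwardOrbit_eq_of_mem (hc.neg hN).2.1 hw').symm.trans
      (forwardOrbit_eq_of_mem hc.2.1 hw))
  have hfin := finite_forwardOrbit hc.2.1
  rw [symmetricOrbit, Set.ncard_union_eq hdisj hfin (by rw [himg]; exact hfin.image _), himg,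
    Set.ncard_image_of_injective _ neg_injective, ncard_forwardOrbit hc.2.1]
  ring

/-- Passive steps do not move the point in Tangent space, so the representation can be advanced
until the next step is active. -/
theorem exists_active (hN : 2 ≤ N) (hc : Live N c) {w : ℝ × ℝ} (hw : w ∈ symmetricOrbit N c)
    (j : ℤ) : ∃ v ∈ activeOrbit N c, ∃ i < 2 * N,
      rot N j * tangentPt N w = rot N (i : ℕ) * tangentPt N v := by
  obtain ⟨n, hn⟩ := (hc.of_mem_symmetricOrbit hN hw).map.exists_mode_one hN
  have active : ∀ {w : ℝ × ℝ}, w ∈ symmetricOrbit N c → mode N (Df N w) = 1 → ∀ j : ℤ,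
      ∃ v ∈ activeOrbit N c, ∃ i < 2 * N,
        rot N j * tangentPt N w = rot N (i : ℕ) * tangentPt N v := by
    intro w hw h j
    obtain ⟨i, hi, h2⟩ := exists_nat_rot_eq hN j
    exact ⟨w, ⟨hw, h⟩, i, hi, by rw [h2]⟩
  induction n generalizing w j with
  | zero => exact active hw hn j
  | succ n ih =>
    rcases mode_cases (N := N) (Df N w) with h | h
    · rw [(hc.of_mem_symmetricOrbit hN hw).rot_tangentPt_passive hN h]
      exact ih (map_mem_symmetricOrbit hN hc hw) _ hn
    · exact active hw h j

theorem exists_of_mem_tangentTiles (hN : 2 ≤ N) (hc : Live N c) {W : Set ℂ}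
    (hW : W ∈ tangentTiles N (DfCell N c)) : ∃ w ∈ symmetricOrbit N c, ∃ j : ℤ,
      W = TauCell N (rot N j * tangentPt N w) := by
  obtain ⟨V, hV, j, -, n, rfl⟩ := hW
  rw [trapezoidTiles_eq hN hc] at hV
  obtain ⟨w, hw, rfl⟩ := hV
  change ∃ v ∈ symmetricOrbit N c, ∃ i : ℤ, (tau N)^[n] '' ((fun w => rot N j * w) '' _) = _
  induction n with
  | zero =>
    have hl := hc.of_mem_symmetricOrbit hN hw
    rw [Function.iterate_zero, Set.image_id]
    rcases mode_cases (N := N) w with h | h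
    · exact ⟨w, hw, j, (tauCell_eq_of_mode_zero hN hl h j).symm⟩
    -- A trapezoid tile of mode `1` is the half turn of the one at `-w`, which has mode `0` and
    -- needs no shift.
    · have h' : mode N (-w) = 0 := by rw [hl.mode_neg hN, h]; rfl
      refine ⟨-w, neg_mem_symmetricOrbit hw, j + N, ?_⟩
      rw [tauCell_eq_of_mode_zero hN (hl.neg hN) h', ← image_rot_toTrapezoid_neg hN (hl.neg hN).1,
        neg_neg]
      rfl
  | succ n ih =>
    obtain ⟨v, hv, i, h⟩ := ih
    obtain ⟨u, hu, m, -, h2⟩ := exists_active hN hc hv i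
    refine ⟨Df N u, map_mem_symmetricOrbit hN hc hu.1, m + 1 + N, ?_⟩
    rw [Function.iterate_succ', Set.image_comp, h, h2]
    exact image_tau_tauCell hN (hc.of_mem_symmetricOrbit hN hu.1) hu.2 m

theorem image_tau_mem_tangentTiles {U : Set (ℝ × ℝ)} {W : Set ℂ} (hW : W ∈ tangentTiles N U) :
    tau N '' W ∈ tangentTiles N U := by
  obtain ⟨V, hV, j, hj, n, rfl⟩ := hW
  exact ⟨V, hV, j, hj, n + 1, by rw [Function.iterate_succ', Set.image_comp]⟩

/-- Tiles of mode `0` are rotated trapezoid tiles. Any other is reached from a point of mode `0` on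
the same `Df`-orbit, each step into mode `1` being an application of `τ`. -/
theorem tauCell_mem_tangentTiles (hN : 2 ≤ N) (hc : Live N c) {w : ℝ × ℝ}
    (hw : w ∈ symmetricOrbit N c) (j : ℤ) :
    TauCell N (rot N j * tangentPt N w) ∈ tangentTiles N (DfCell N c) := by
  have base : ∀ {w : ℝ × ℝ}, w ∈ symmetricOrbit N c → mode N w = 0 → ∀ j : ℤ,
      TauCell N (rot N j * tangentPt N w) ∈ tangentTiles N (DfCell N c) := by
    intro w hw h j
    have hl := hc.of_mem_symmetricOrbit hN hw
    have key : ∀ v ∈ symmetricOrbit N c, ∀ i : ℕ, i < N →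
        (fun w => rot N i * w) '' (toTrapezoid N '' DfCell N v) ∈ tangentTiles N (DfCell N c) := by
      intro v hv i hi
      refine ⟨toTrapezoid N '' DfCell N v, ?_, i, hi, 0, ?_⟩
      · rw [trapezoidTiles_eq hN hc]; exact ⟨v, hv, rfl⟩
      · rw [Function.iterate_zero, Set.image_id]; rfl
    obtain ⟨i, hi, h2⟩ := exists_nat_rot_eq hN j
    rw [tauCell_eq_of_mode_zero hN hl h, h2]
    rcases lt_or_ge i N with h3 | h3
    · exact key w hw i h3
    -- Only `N` of the `2N` rotations are allowed in `tangentTiles`; the others come from `-w` by a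
    -- half turn.
    · obtain ⟨l, rfl⟩ := Nat.exists_eq_add_of_le' h3
      have h4 := key (-w) (neg_mem_symmetricOrbit hw) l (by omega)
      have h5 := image_rot_toTrapezoid_neg hN hl.1 l
      rw [Int.cast_natCast] at h5
      rw [h5] at h4
      push_cast at h4 ⊢
      exact h4
  have hl := hc.of_mem_symmetricOrbit hN hw
  obtain ⟨n, hn⟩ := hl.exists_mode_zero hN
  obtain ⟨m, hm⟩ := exists_iterate_iterate_eq hl.2.1 n
  have hv := iterate_mem_symmetricOrbit hN hc hw n
  rw [← hm]
  generalize (Df N)^[n] w = v at hn hv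
  clear hm
  induction m generalizing j with
  | zero => exact base hv hn j
  | succ m ih =>
    have hv' := iterate_mem_symmetricOrbit hN hc hv m
    rw [Function.iterate_succ_apply']
    rcases mode_cases (N := N) (Df N ((Df N)^[m] v)) with h | h
    · exact base (map_mem_symmetricOrbit hN hc hv') h j
    · have h1 := image_tau_mem_tangentTiles (ih (j - 1 - N))
      rwa [image_tau_tauCell hN (hc.of_mem_symmetricOrbit hN hv') h,
        show j - 1 - N + 1 + (N : ℤ) = j by ring] at h1

/-- The indices of the tiles in Tangent space. -/
def tileIndex (N : ℕ) (c : ℝ × ℝ) : Set ((ℝ × ℝ) × ℕ) :=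
  activeOrbit N c ×ˢ (Finset.range (2 * N) : Set ℕ)

theorem tangentTiles_eq (hN : 2 ≤ N) (hc : Live N c) :
    tangentTiles N (DfCell N c) =
      (fun q : (ℝ × ℝ) × ℕ => TauCell N (rot N q.2 * tangentPt N q.1)) '' tileIndex N c := by
  apply Set.Subset.antisymm
  · intro W hW
    obtain ⟨w, hw, j, rfl⟩ := exists_of_mem_tangentTiles hN hc hW
    obtain ⟨v, hv, i, hi, h⟩ := exists_active hN hc hw j
    exact ⟨(v, i), ⟨hv, by simpa using hi⟩, by rw [h]⟩
  · rintro _ ⟨⟨v, i⟩, ⟨hv, -⟩, rfl⟩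
    exact_mod_cast tauCell_mem_tangentTiles hN hc hv.1 i

theorem injOn_tileIndex (hN : 2 ≤ N) (hc : Live N c) :
    Set.InjOn (fun q : (ℝ × ℝ) × ℕ => rot N q.2 * tangentPt N q.1) (tileIndex N c) := by
  rintro ⟨v, i⟩ ⟨hv, hi⟩ ⟨w, j⟩ ⟨hw, hj⟩ h
  simp only [Finset.coe_range, Set.mem_Iio] at hi hj
  obtain ⟨h1, h2⟩ := rot_tangentPt_injective hN (hc.of_mem_symmetricOrbit hN hv.1)
    (hc.of_mem_symmetricOrbit hN hw.1) hv.2 hw.2 hi hj h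
  exact Prod.ext h2 h1

theorem ncard_tileIndex (hN : 2 ≤ N) (hc : Live N c) :
    (tileIndex N c).ncard = (symmetricOrbit N c).ncard * N := by
  rw [tileIndex, Set.ncard_prod, Set.ncard_coe_finset, Finset.card_range,
    ncard_symmetricOrbit hN hc]
  ring

theorem center_tile (hN : 2 ≤ N) (hc : Live N c) (hcc : center (DfCell N c) = c)
    {q : (ℝ × ℝ) × ℕ} (hq : q ∈ tileIndex N c) :
    center (TauCell N (rot N q.2 * tangentPt N q.1)) = rot N q.2 * tangentPt N q.1 := by
  have := center_tauCell hN (hc.of_mem_symmetricOrbit hN hq.1.1)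
    (center_of_mem_symmetricOrbit hN hc hcc hq.1.1) q.2
  rwa [Int.cast_natCast] at this

theorem center_image_tangentTiles (hN : 2 ≤ N) (hc : Live N c) (hcc : center (DfCell N c) = c) :
    center '' tangentTiles N (DfCell N c) =
      (fun q : (ℝ × ℝ) × ℕ => rot N q.2 * tangentPt N q.1) '' tileIndex N c := by
  rw [tangentTiles_eq hN hc, Set.image_image]
  exact Set.image_congr fun q hq => center_tile hN hc hcc hq

theorem ncard_tangentTiles (hN : 2 ≤ N) (hc : Live N c) (hcc : center (DfCell N c) = c) :
    (tangentTiles N (DfCell N c)).ncard = (symmetricOrbit N c).ncard * N := by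
  rw [tangentTiles_eq hN hc, Set.InjOn.ncard_image, ncard_tileIndex hN hc]
  intro p hp q hq h
  have := congrArg center h
  simp only [center_tile hN hc hcc hp, center_tile hN hc hcc hq] at this
  exact injOn_tileIndex hN hc hp hq this

theorem pairwiseDisjoint_tangentTiles (hN : 2 ≤ N) (hc : Live N c) :
    (tangentTiles N (DfCell N c)).PairwiseDisjoint id := by
  rw [tangentTiles_eq hN hc]
  rintro _ ⟨p, -, rfl⟩ _ ⟨q, -, rfl⟩ hne
  exact (tauCell_eq_or_disjoint _ _).resolve_left hne

theorem exists_tile_representatives (hN : 2 ≤ N) (hc : Live N c)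
    (hcc : center (DfCell N c) = c) :
    ∃ R : Finset ℂ, (∀ r ∈ R, r ∈ center '' tangentTiles N (DfCell N c)) ∧
      (∀ p ∈ center '' tangentTiles N (DfCell N c),
        ∃! r : ℂ, r ∈ R ∧ ∃ n : ℕ, (tau N)^[n] r = p) ∧
      ∑ r ∈ R, Function.minimalPeriod (tau N) r = (symmetricOrbit N c).ncard * N := by
  rw [center_image_tangentTiles hN hc hcc, ← ncard_tileIndex hN hc,
    ← (injOn_tileIndex hN hc).ncard_image]
  apply exists_orbit_representatives
  · have hfin : (activeOrbit N c).Finite :=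
      (finite_symmetricOrbit hc.2.1).subset fun w hw => hw.1
    exact (hfin.prod (Finset.finite_toSet _)).image _
  · rintro _ ⟨⟨v, i⟩, ⟨hv, -⟩, rfl⟩
    have h1 := (hc.of_mem_symmetricOrbit hN hv.1).tau_rot_active hN hv.2 i
    obtain ⟨u, hu, m, hm, h2⟩ := exists_active hN hc (map_mem_symmetricOrbit hN hc hv.1) (i + 1 + N)
    refine ⟨(u, m), ⟨hu, by simpa using hm⟩, ?_⟩
    rw [Int.cast_natCast] at h1
    exact (h1.trans h2).symm
  · rintro _ ⟨⟨v, i⟩, ⟨hv, -⟩, rfl⟩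
    exact_mod_cast (hc.of_mem_symmetricOrbit hN hv.1).tangentPt_mem_periodicPts hN i

/-- If all symbols vanished, the constant orbit at the origin would have the same symbol sequence.
-/
theorem live_of_zero_notMem (hN : 2 ≤ N) (hr : c ∈ DfRegular N)
    (hp : c ∈ Function.periodicPts (Df N)) (h0 : (0 : ℝ × ℝ) ∉ DfCell N c) : Live N c := by
  refine ⟨hr, hp, ?_⟩
  by_contra hcon
  push Not at hcon
  have h1 : ∀ n : ℕ, |(fun _ : ℕ => (0 : ℝ)) n| < 1 := by simp
  have hX : ∀ n : ℕ, (fun _ : ℕ => (0 : ℝ)) (n + 2) = 2 * Real.cos (angle N) *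
      (fun _ : ℕ => (0 : ℝ)) (n + 1) - (fun _ : ℕ => (0 : ℝ)) n -
        2 * ((fun _ : ℕ => (0 : ℤ)) n : ℤ) := by simp
  refine h0 ⟨DfRegular.of_recurrence hN h1 hX, fun n => ?_⟩
  rw [hcon]
  exact (iterate_of_recurrence hN h1 hX n).2

end tiles

end DigitalFilter

theorem mainTheorem1 (N : ℕ) (hN : 2 ≤ N) (U : Set (ℝ × ℝ))
    (hU : DigitalFilter.IsDfPeriodicRegion N U) (hU0 : (0 : ℝ × ℝ) ∉ U)
    (k : ℕ) (hk : k = DigitalFilter.DfPeriod N U) :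
    -- the region contains its center, which is periodic
    (DigitalFilter.center U ∈ U ∧ 0 < k) ∧
    ∃ m : ℕ,
      -- `m = 2k`, unless the orbit of the center is its own point reflection
      (DigitalFilter.complementaryOrbit N U ≠ DigitalFilter.centerOrbit N U → m = 2 * k) ∧
      (DigitalFilter.complementaryOrbit N U = DigitalFilter.centerOrbit N U → m = k) ∧
      -- `m` congruent tiles in trapezoid space
      (DigitalFilter.trapezoidTiles N U).ncard = m ∧
      (DigitalFilter.trapezoidTiles N U).PairwiseDisjoint id ∧
      (∀ V ∈ DigitalFilter.trapezoidTiles N U,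
        (∃ U', DigitalFilter.IsDfPeriodicRegion N U' ∧ V = DigitalFilter.toTrapezoid N '' U') ∧
        DigitalFilter.AreCongruent (DigitalFilter.toTrapezoid N '' U) V) ∧
      -- `m N` congruent tiles in Tangent space
      (DigitalFilter.tangentTiles N U).ncard = m * N ∧
      (DigitalFilter.tangentTiles N U).PairwiseDisjoint id ∧
      (∀ W ∈ DigitalFilter.tangentTiles N U,
        DigitalFilter.IsTauPeriodicTile N W ∧
        DigitalFilter.AreCongruent (DigitalFilter.toTrapezoid N '' U) W ∧
        DigitalFilter.center W ∈ W ∧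
        DigitalFilter.center W ∈ Function.periodicPts (DigitalFilter.tau N)) ∧
      -- the periods of the orbits formed by the centers of these tiles sum to `m N`
      (∃ R : Finset ℂ,
        (∀ r ∈ R, r ∈ DigitalFilter.center '' DigitalFilter.tangentTiles N U) ∧
        (∀ p ∈ DigitalFilter.center '' DigitalFilter.tangentTiles N U,
          ∃! r : ℂ, r ∈ R ∧ ∃ n : ℕ, (DigitalFilter.tau N)^[n] r = p) ∧
        ∑ r ∈ R, Function.minimalPeriod (DigitalFilter.tau N) r = m * N) := by
  open DigitalFilter in
  obtain ⟨z, hz, hzp, hUz⟩ := hU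
  have hmem : center U ∈ U := by rw [hUz]; exact center_DfCell_mem hN hz hzp
  obtain ⟨c, hc⟩ : ∃ c, c = center U := ⟨_, rfl⟩
  have hcz : c ∈ DfCell N z := by rw [hc, ← hUz]; exact hmem
  -- The region is rebased at its center, so that the base point and the centroid coincide in the
  -- counting.
  have hUc : U = DfCell N c := hUz.trans (DfCell_eq_of_mem hcz).symm
  have hcp : c ∈ Function.periodicPts (Df N) := by
    obtain ⟨l, hl0, hl⟩ := hzp
    exact ⟨_, Nat.mul_pos hl0 (show 0 < 2 * N by omega),
      isPeriodicPt_of_mem_DfCell hN hz hl hcz⟩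
  have hcr : c ∈ DfRegular N := hcz.1
  have hcc : center (DfCell N c) = c := by rw [← hUc, hc]
  have hk' : k = Function.minimalPeriod (Df N) c := by rw [hk, hc]; rfl
  have hO : centerOrbit N U = forwardOrbit (Df N) c := by rw [hc]; rfl
  have hO' : complementaryOrbit N U = {w | -w ∈ forwardOrbit (Df N) c} := by rw [hc]; rfl
  have hl : Live N c := live_of_zero_notMem hN hcr hcp (hUc ▸ hU0)
  refine ⟨⟨hmem, ?_⟩, (symmetricOrbit N c).ncard, ?_, ?_, ?_⟩
  · rw [hk']; exact Function.minimalPeriod_pos_of_mem_periodicPts hcp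
  · rw [hO, hO', hk']; exact ncard_symmetricOrbit_of_ne hN hl
  · rw [hO, hO', hk']; exact ncard_symmetricOrbit_of_eq hcp
  · rw [hUc]
    refine ⟨?_, pairwiseDisjoint_trapezoidTiles hN hl, ?_, ncard_tangentTiles hN hl hcc,
      pairwiseDisjoint_tangentTiles hN hl, ?_, exists_tile_representatives hN hl hcc⟩
    · rw [trapezoidTiles_eq hN hl, (DfCell_injOn hN hl hcc).ncard_image]
    · intro V hV
      rw [trapezoidTiles_eq hN hl] at hV
      obtain ⟨w, hw, rfl⟩ := hV
      have hlw := hl.of_mem_symmetricOrbit hN hw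
      exact ⟨⟨_, ⟨w, hlw.1, hlw.2.1, rfl⟩, rfl⟩, areCongruent_of_mem_symmetricOrbit hN hl hw⟩
    · intro W hW
      obtain ⟨w, hw, j, rfl⟩ := exists_of_mem_tangentTiles hN hl hW
      have hlw := hl.of_mem_symmetricOrbit hN hw
      have hreg := hlw.tangentPt_mem_tauRegular hN j
      have hper := hlw.tangentPt_mem_periodicPts hN j
      rw [center_tauCell hN hlw (center_of_mem_symmetricOrbit hN hl hcc hw)]
      exact ⟨⟨_, hreg, hper, rfl⟩,
        (areCongruent_of_mem_symmetricOrbit hN hl hw).trans (areCongruent_tauCell hN hlw j),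
        mem_tauCell_self hreg, hper⟩
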